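/- Let $0<q,t<1$ and $\gamma>0$. Let $\mathbb{Y}$ be the set of partitions, $\Lambda$ the ring of symmetric functions over $\mathbb{R}$ with power sums $p_n$ and bilinear form $\langle p_\lambda,p_\mu\rangle=\delta_{\lambda\mu}\prod_{i}m_i(\lambda)!\,i^{m_i(\lambda)}\prod_{i\le\ell(\lambda)}\frac{1-q^{\lambda_i}}{1-t^{\lambda_i}}$, let $P_\lambda$ be the Macdonald symmetric functions with parameters $q,t$, $Q_\lambda=P_\lambda/\langle P_\lambda,P_\lambda\rangle$, and let $P_{\lambda/\mu},Q_{\lambda/\mu}$ be the skew functions, given by $P_\lambda(X,Y)=\sum_\mu P_{\lambda/\mu}(X)P_\mu(Y)$ and $Q_\lambda(X,Y)=\sum_\mu Q_{\lambda/\mu}(X)Q_\mu(Y)$. For $\xi>0$ let $\rho_\xi:\Lambda\to\mathbb{R}$ be the Plancherel specialization, i.e. the algebra homomorphism with $\rho_\xi(p_n)=\xi\,\delta_{n,1}$. Let $\mathcal{F}$ be the Fock space of the Heisenberg algebra $[a_m,a_n]=m\frac{1-q^{|m|}}{1-t^{|m|}}\delta_{m+n,0}$, identified with $\Lambda$ by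 $a_{-\lambda_1}a_{-\lambda_2}\cdots|0\rangle\mapsto p_\lambda$ (and its dual by $\langle 0|a_{\lambda_1}a_{\lambda_2}\cdots\mapsto p_\lambda$), let $D$ be the degree operator, $D|p_\lambda\rangle=|\lambda|\,|p_\lambda\rangle$, and let $\Gamma(\rho)_\pm=\exp\bigl(\sum_{n>0}\frac{1-t^n}{1-q^n}\frac{\rho(p_n)}{n}a_{\pm n}\bigr)$. For $u\in(0,1)$ put $$\mathcal{T}^{(\gamma)}(u)=e^{\frac{1-t}{1-q}\gamma^2(u-1)}\,\Gamma(\rho_{\gamma(1-u)})_-\,u^D\,\Gamma(\rho_{\gamma(1-u)})_+,\qquad T^{(\gamma)}_{\lambda\mu}(u)=\langle P_\lambda|\mathcal{T}^{(\gamma)}(u)|Q_\mu\rangle .$$ For $\beta>0$, the stationary $\beta$-periodic Macdonald Plancherel process of intensity $\gamma$ is a $\mathbb{Y}$-valued stochastic process $(\lambda(s):s\in\mathbb{R})$ with $\lambda(s+\beta)=\lambda(s)$ a.s. for every $s$ and, for all $n\ge 0$, all $0=b_0<b_1<\dots<b_n<b_{n+1}=\beta$ and all $\lambda^0,\dots,\lambda^n\in\mathbb{Y}$,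 $$\mathrm{Prob}\bigl(\lambda(b_i)=\lambda^i,\ i=0,\dots,n\bigr)=(e^{-\beta};e^{-\beta})_\infty\prod_{i=0}^{n}T^{(\gamma)}_{\lambda^i\lambda^{i+1}}\bigl(e^{-(b_{i+1}-b_i)}\bigr),\qquad \lambda^{n+1}:=\lambda^0,$$ where $(a;x)_\infty=\prod_{i\ge0}(1-ax^i)$. For $0<u<1$, $N\ge 1$ and specializations $\rho^+=(\rho^+_0,\dots,\rho^+_{N-1})$, $\rho^-=(\rho^-_1,\dots,\rho^-_N)$ put $$W_u^{\rho^+,\rho^-}(\boldsymbol\lambda,\boldsymbol\mu)=u^{|\mu^N|}\prod_{i=1}^{N}Q_{\lambda^i/\mu^i}(\rho^-_i)\,P_{\lambda^{i+1}/\mu^i}(\rho^+_i),\qquad \lambda^{N+1}:=\lambda^1,\ \rho^+_N:=\rho^+_0,$$ and let the $N$-step periodic Macdonald process be given by $\mathbb{P}_u^{\rho^+,\rho^-}(\boldsymbol\lambda)=\sum_{\boldsymbol\mu\in\mathbb{Y}^N}W_u^{\rho^+,\rho^-}(\boldsymbol\lambda,\boldsymbol\mu)\Big/\sum_{\boldsymbol\lambda,\boldsymbol\mu\in\mathbb{Y}^N}W_u^{\rho^+,\rho^-}(\boldsymbol\lambda,\boldsymbol\mu)$.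 Then the following hold. (1) $\mathcal{T}^{(\gamma)}(u)\mathcal{T}^{(\gamma)}(v)=\mathcal{T}^{(\gamma)}(uv)$ for all $u,v\in(0,1)$, in the sense that $\sum_{\mu\in\mathbb{Y}}T^{(\gamma)}_{\lambda\mu}(u)\,T^{(\gamma)}_{\mu\nu}(v)=T^{(\gamma)}_{\lambda\nu}(uv)$ for all $\lambda,\nu\in\mathbb{Y}$, where the sum converges absolutely. (2) Let $(\lambda(s):s\in\mathbb{R})$ be a stationary $\beta$-periodic Macdonald Plancherel process of intensity $\gamma$ and let $0=b_0<b_1<\dots<b_n<b_{n+1}=\beta$, $n\ge0$. Put $\rho^+_0=\rho_{\gamma(1-e^{b_n-\beta})}$, $\rho^+_i=\rho_{\gamma(e^{b_i}-e^{b_{i-1}})}$ for $i=1,\dots,n$, and $\rho^-_i=\rho_{\gamma(e^{-b_{i-1}}-e^{-b_i})}$ for $i=1,\dots,n+1$. Then the weights $W_{e^{-\beta}}^{\rho^+,\rho^-}$ are summable with positive sum, and the law of $(\lambda(b_0),\dots,\lambda(b_n))$ is the corresponding $(n+1)$-step periodic Macdonald process at $u=e^{-\beta}$: $$\mathrm{Prob}\bigl(\lambda(b_i)=\lambda^i,\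 i=0,\dots,n\bigr)=\mathbb{P}^{\rho^+,\rho^-}_{e^{-\beta}}(\lambda^0,\lambda^1,\dots,\lambda^n)\qquad(\lambda^0,\dots,\lambda^n\in\mathbb{Y}).$$ -/

import Mathlib

open scoped TensorProduct
open MeasureTheory

namespace PeriodicMacdonald

noncomputable section

/-- The set of all partitions; `lam.1` is the weight `|lam|`, `lam.2` the partition of it. -/
abbrev YSet : Type := Σ n : ℕ, n.Partition

/-- Sum of the `k` largest parts of a partition. -/
def partialSum {n : ℕ} (lam : n.Partition) (k : ℕ) : ℕ :=
  ((lam.parts.sort (· ≥ ·)).take k).sum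

/-- Strict dominance order `mu < lam` on partitions of the same number. -/
def StrictlyDominated {n : ℕ} (mu lam : n.Partition) : Prop :=
  mu ≠ lam ∧ ∀ k : ℕ, partialSum mu k ≤ partialSum lam k

/-! ### Symmetric functions -/

/-- The ring of symmetric functions over `ℝ` in infinitely many variables, presented by its
algebraically independent generators, the power sums: the variable `X r` is the `r`-th power sum
`p_r`, `r = 1, 2, …`. Its elements are turned into actual symmetric polynomials
by `reduction`. -/
abbrev SymFun : Type := MvPolynomial ℕ+ ℝ

/-- The `r`-th power sum `p_r`. -/
def psym (r : ℕ+) : SymFun := MvPolynomial.X r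

/-- The power sum `p_lam = p_{lam_1} p_{lam_2} ⋯` of a partition. -/
def pPart (lam : YSet) : SymFun := (lam.2.parts.map fun k => psym k.toPNat').prod

/-- The `k`-variable reduction `F ↦ F(x_1, …, x_k)`: it sends `p_r` to `x_1 ^ r + ⋯ + x_k ^ r`. -/
def reduction (k : ℕ) : SymFun →ₐ[ℝ] MvPolynomial (Fin k) ℝ :=
  MvPolynomial.aeval fun r : ℕ+ => MvPolynomial.psum (Fin k) ℝ (r : ℕ)

/-- `z_lam(q,t)` for the partition `lam = (1^{d 1} 2^{d 2} ⋯)`, given by its multiplicities `d`;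
the monomial `∏ r, p_r ^ d r` is `p_lam`. -/
def zWeight (q t : ℝ) (d : ℕ+ →₀ ℕ) : ℝ :=
  d.prod fun r m => (m.factorial : ℝ) * ((r : ℕ) : ℝ) ^ m *
    ((1 - q ^ (r : ℕ)) / (1 - t ^ (r : ℕ))) ^ m

/-- The Macdonald bilinear form, `⟨p_lam, p_mu⟩ = z_lam(q,t) δ_{lam,mu}`. -/
def pairing (q t : ℝ) (f g : SymFun) : ℝ :=
  ∑ d ∈ f.support, f.coeff d * g.coeff d * zWeight q t d

/-- The characterization of the Macdonald symmetric functions: they are unitriangular with respect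
to the monomial symmetric functions and the dominance order, and pairwise orthogonal. The expansion
in monomial symmetric functions is an identity of symmetric polynomials in each number of
variables. -/
structure IsMacdonaldFamily (q t : ℝ) (P : YSet → SymFun) : Prop where
  triangular : ∀ lam : YSet, ∃ c : lam.1.Partition → ℝ,
    (∀ mu, c mu ≠ 0 → StrictlyDominated mu lam.2) ∧
    ∀ k : ℕ, reduction k (P lam) = MvPolynomial.msymm (Fin k) ℝ lam.2 +
      ∑ mu, c mu • MvPolynomial.msymm (Fin k) ℝ mu
  orthogonal : ∀ lam mu : YSet, lam ≠ mu → pairing q t (P lam) (P mu) = 0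

open Classical in
/-- The Macdonald symmetric function `P_lam(q,t)` for real `q, t ∈ (0,1)`: the (unique) family with
the characterizing properties. (It exists for all such `q, t`; the power sums in the other case are
only a placeholder.) -/
def macP (q t : ℝ) : YSet → SymFun :=
  if h : ∃ P : YSet → SymFun, IsMacdonaldFamily q t P then h.choose else pPart

/-- The dual Macdonald symmetric function `Q_lam = P_lam / ⟨P_lam, P_lam⟩`. -/
def macQ (q t : ℝ) (lam : YSet) : SymFun :=
  (pairing q t (macP q t lam) (macP q t lam))⁻¹ • macP q t lam

/-- The substitution `F ↦ F(X, Y)` of two sets of variables: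
`p_r(X, Y) = p_r(X) + p_r(Y)`. -/
def twoAlphabets : SymFun →ₐ[ℝ] SymFun ⊗[ℝ] SymFun :=
  MvPolynomial.aeval fun r : ℕ+ => psym r ⊗ₜ[ℝ] (1 : SymFun) + (1 : SymFun) ⊗ₜ[ℝ] psym r

open Classical in
/-- The coefficient of `b mu` in the expansion of a symmetric function in a basis `b`. -/
def expansionCoeff (b : YSet → SymFun) (mu : YSet) : SymFun →ₗ[ℝ] ℝ :=
  if h : LinearIndependent ℝ b ∧ ⊤ ≤ Submodule.span ℝ (Set.range b) then
    (Module.Basis.mk h.1 h.2).coord mu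
  else 0

/-- The skew functions `b_{lam/mu}` of a basis, defined by
`b_lam(X, Y) = ∑ mu, b_{lam/mu}(X) b_mu(Y)`. -/
def skew (b : YSet → SymFun) (lam mu : YSet) : SymFun :=
  TensorProduct.rid ℝ SymFun ((expansionCoeff b mu).lTensor SymFun (twoAlphabets (b lam)))

/-- `P_{lam/mu}(q,t)`. -/
def skewP (q t : ℝ) (lam mu : YSet) : SymFun := skew (macP q t) lam mu

/-- `Q_{lam/mu}(q,t)`. -/
def skewQ (q t : ℝ) (lam mu : YSet) : SymFun := skew (macQ q t) lam mu

/-- The Plancherel specialization `ρ_ξ`, `ρ_ξ(p_r) = ξ δ_{r,1}`. -/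
def plancherel (ξ : ℝ) : SymFun →ₐ[ℝ] ℝ :=
  MvPolynomial.aeval fun r : ℕ+ => if r = 1 then ξ else 0

/-! ### Periodic Macdonald processes

For `N = n + 1` steps everything is indexed by `Fin (n + 1)`, whose addition is cyclic. In terms of
the usual labels, `lam i = λ^{i+1}`, `mu i = μ^{i+1}`, `rm i = ρ^-_{i+1}`, `rp i = ρ^+_i` for
`i = 0, …, N - 1`, with `λ^{N+1} = λ^1` and `ρ^+_N = ρ^+_0`. -/

/-- The weight `u^{|μ^N|} ∏_{i=1}^N Q_{λ^i/μ^i}(ρ^-_i) P_{λ^{i+1}/μ^i}(ρ^+_i)`. -/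
def periodicWeight (q t u : ℝ) {n : ℕ} (rp rm : Fin (n + 1) → (SymFun →ₐ[ℝ] ℝ))
    (lam mu : Fin (n + 1) → YSet) : ℝ :=
  u ^ (mu (Fin.last n)).1 *
    ∏ i : Fin (n + 1), rm i (skewQ q t (lam i) (mu i)) *
      rp (i + 1) (skewP q t (lam (i + 1)) (mu i))

/-- The partition function: the sum of all weights. -/
def partitionFunction (q t u : ℝ) {n : ℕ} (rp rm : Fin (n + 1) → (SymFun →ₐ[ℝ] ℝ)) : ℝ :=
  ∑' x : (Fin (n + 1) → YSet) × (Fin (n + 1) → YSet), periodicWeight q t u rp rm x.1 x.2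

/-- The probability of `(λ^1, …, λ^N)` under the `N`-step periodic Macdonald process. -/
def periodicMacdonald (q t u : ℝ) {n : ℕ} (rp rm : Fin (n + 1) → (SymFun →ₐ[ℝ] ℝ))
    (lam : Fin (n + 1) → YSet) : ℝ :=
  (∑' mu : Fin (n + 1) → YSet, periodicWeight q t u rp rm lam mu) /
    partitionFunction q t u rp rm

/-! ### Fock space

The Fock space and its dual are identified with the ring of symmetric functions by sending both
`a_{-lam_1} a_{-lam_2} ⋯ |0⟩` and `⟨0| a_{lam_1} a_{lam_2} ⋯` to `p_lam`; their pairing becomes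
`pairing q t`. -/

/-- The action of the Heisenberg generator `a_n` on the Fock space, where
`[a_m, a_n] = m (1 - q^|m|) / (1 - t^|m|) δ_{m+n,0}`: `a_{-n}` creates a factor `p_n` and `a_n` is
`n (1 - q^n) / (1 - t^n) ∂/∂p_n`, `n > 0`. (There is no `a_0`.) -/
def heis (q t : ℝ) : ℤ → Module.End ℝ SymFun
  | Int.ofNat 0 => 0
  | Int.ofNat (n + 1) =>
      (((n + 1 : ℕ) : ℝ) * ((1 - q ^ (n + 1)) / (1 - t ^ (n + 1)))) •
        (MvPolynomial.pderiv n.succPNat : Derivation ℝ SymFun SymFun).toLinearMap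
  | Int.negSucc n => LinearMap.mulLeft ℝ (psym n.succPNat)

/-- The right action of `a_n` on the dual Fock space, `⟨v| ↦ ⟨v| a_n`: here the `a_n` with `n > 0`
create a factor `p_n`, and the `a_{-n}` annihilate. -/
def heisRight (q t : ℝ) (n : ℤ) : Module.End ℝ SymFun := heis q t (-n)

/-- `exp (∑_{n>0} (1 - t^n) / (1 - q^n) ρ(p_n) / n a n)` applied to `v`, for operators `a n` that
lower the degree, so that all sums have only finitely many nonzero terms. -/
def vertexExp (q t : ℝ) (ρ : SymFun →ₐ[ℝ] ℝ) (a : ℕ+ → Module.End ℝ SymFun) (v : SymFun) : SymFun :=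
  ∑ᶠ k : ℕ, ((k.factorial : ℝ)⁻¹) •
    (fun w : SymFun => ∑ᶠ n : ℕ+,
      ((1 - t ^ (n : ℕ)) / (1 - q ^ (n : ℕ)) * (ρ (psym n) / ((n : ℕ) : ℝ))) • a n w)^[k] v

/-- The vector `Γ(ρ)_+ |v⟩`. -/
def gammaPlusKet (q t : ℝ) (ρ : SymFun →ₐ[ℝ] ℝ) (v : SymFun) : SymFun :=
  vertexExp q t ρ (fun n => heis q t ((n : ℕ) : ℤ)) v

/-- The covector `⟨v| Γ(ρ)_-`. -/
def braGammaMinus (q t : ℝ) (ρ : SymFun →ₐ[ℝ] ℝ) (v : SymFun) : SymFun :=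
  vertexExp q t ρ (fun n => heisRight q t (-((n : ℕ) : ℤ))) v

/-- The operator `u^D`, `u^D p_lam = u^{|lam|} p_lam`. -/
def degreeOp (u : ℝ) : SymFun →ₐ[ℝ] SymFun :=
  MvPolynomial.aeval fun r : ℕ+ => u ^ (r : ℕ) • psym r

/-- The matrix element `⟨P_lam| 𝒯(u) |Q_mu⟩` of the transfer operator
`𝒯(u) = exp ((1 - t) / (1 - q) γ² (u - 1)) Γ(ρ_{γ(1-u)})_- u^D Γ(ρ_{γ(1-u)})_+`. -/
def transfer (q t γ u : ℝ) (lam mu : YSet) : ℝ :=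
  Real.exp ((1 - t) / (1 - q) * γ ^ 2 * (u - 1)) *
    pairing q t (braGammaMinus q t (plancherel (γ * (1 - u))) (macP q t lam))
      (degreeOp u (gammaPlusKet q t (plancherel (γ * (1 - u))) (macQ q t mu)))

/-! ### The stationary periodic Macdonald Plancherel process -/

/-- The infinite `q`-Pochhammer symbol `(a;x)_∞ = ∏_{i ≥ 0} (1 - a x^i)`. -/
def qPochhammer (a x : ℝ) : ℝ := ∏' i : ℕ, (1 - a * x ^ i)

/-- `0 = b 0 < b 1 < ⋯ < b n < b (n + 1) = β`. -/
structure IsTimeSequence (β : ℝ) (n : ℕ) (b : ℕ → ℝ) : Prop where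
  zero : b 0 = 0
  last : b (n + 1) = β
  lt : ∀ i ≤ n, b i < b (i + 1)

/-- The process `X` obeys the law of the stationary `β`-periodic Macdonald Plancherel process of
intensity `γ`. In the finite-dimensional laws, `λ^{n+1} = λ^0`. -/
structure IsStationaryPlancherel {Ω : Type*} [MeasurableSpace Ω] (ℙ : Measure Ω)
    (q t γ β : ℝ) (X : ℝ → Ω → YSet) : Prop where
  measurable : ∀ (s : ℝ) (lam : YSet), MeasurableSet {ω | X s ω = lam}
  periodic : ∀ s : ℝ, ∀ᵐ ω ∂ℙ, X (s + β) ω = X s ω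
  law : ∀ (n : ℕ) (b : ℕ → ℝ), IsTimeSequence β n b → ∀ lam : Fin (n + 1) → YSet,
    ℙ.real {ω | ∀ i : Fin (n + 1), X (b (i : ℕ)) ω = lam i} =
      qPochhammer (Real.exp (-β)) (Real.exp (-β)) *
        ∏ i : Fin (n + 1), transfer q t γ (Real.exp (-(b ((i : ℕ) + 1) - b (i : ℕ)))) (lam i) (lam (i + 1))

/-- The specializations `ρ^+_0 = ρ_{γ(1 - e^{b_n - β})}` and
`ρ^+_i = ρ_{γ(e^{b_i} - e^{b_{i-1}})}`, `i = 1, …, n`. -/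
def rhoPlus (γ β : ℝ) (n : ℕ) (b : ℕ → ℝ) (i : Fin (n + 1)) : SymFun →ₐ[ℝ] ℝ :=
  if i = 0 then plancherel (γ * (1 - Real.exp (b n - β)))
  else plancherel (γ * (Real.exp (b (i : ℕ)) - Real.exp (b ((i : ℕ) - 1))))

/-- The specializations `ρ^-_i = ρ_{γ(e^{-b_{i-1}} - e^{-b_i})}`, `i = 1, …, n + 1`; the index
`i : Fin (n + 1)` stands for `ρ^-_{i+1}`. -/
def rhoMinus (γ : ℝ) (n : ℕ) (b : ℕ → ℝ) (i : Fin (n + 1)) : SymFun →ₐ[ℝ] ℝ :=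
  plancherel (γ * (Real.exp (-b (i : ℕ)) - Real.exp (-b ((i : ℕ) + 1))))

end

end PeriodicMacdonald

/-!
Both claims hold for every orthogonal basis of symmetric functions that is homogeneous for the
degree `wt`; nothing else about the Macdonald functions enters (`IsHomOrth`, `isHomOrth_macP`).
Triangularity is used only to see that `P_lam` is homogeneous of degree `|lam|` and nonzero, which
needs that a symmetric function is determined by its reductions
(`eq_zero_of_reduction_eq_zero`), i.e. the algebraic independence of the power sums. In each degree
a matrix inversion then shows that `∑ b ⊗ b^*` does not depend on the orthogonal basis `b`
(`IsHomOrth.sum_dual`), so that square summable expansions may be computed in power sums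
(`IsHomOrth.hasSum_dual`).

For a Plancherel specialization, `Γ(ρ_ξ)_+` is `exp (ξ ∂/∂p_1)`, the shift `p_1 ↦ p_1 + ξ`
(`gammaPlusKet_plancherel`), and `Γ(ρ_ξ)_-` is its adjoint. The matrix elements `kern` of
`Γ_- u^D Γ_+` obey a simple recursion when a state is multiplied by a power sum (`kern_X_mul`).
Induction on the two outer states reduces the semigroup property to the vacuum, where it is the
exponential series (`hasSum_kern_mul_kern`).

For the marginals, a skew function at `ρ_ξ` is a matrix element of a shift (`plancherel_skew`).
Conjugating by powers of the degree operator turns the weight `W` into a cyclic product of matrix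
elements of `w^D` and of vertex operators (`periodicWeight_eq`), whose sum over `μ` is a product of
transfer matrix elements times a constant (`hasSum_periodicWeight`). No positivity is used for
summability: `w^(D/2) Γ(ρ_ξ)_+` is a Hilbert–Schmidt operator (`IsHomOrth.summable_sqElem`), and
`W ^ 2` is a product of two summable cyclic products of its squared matrix elements
(`summable_periodicWeight`). Finally, the probabilities of the process add up to one, which
evaluates the partition function and shows that it is positive.
-/

namespace PeriodicMacdonald

noncomputable section

/-! ### The bilinear form on power sums -/

/-- The degree of the monomial with exponents `d`, the variable `p_r` having degree `r`. -/
abbrev wt : (ℕ+ →₀ ℕ) →+ ℕ := Finsupp.weight fun r : ℕ+ => (r : ℕ)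

/-- The power-sum monomial `∏ r, p_r ^ d r`. -/
abbrev pMon (d : ℕ+ →₀ ℕ) : SymFun := MvPolynomial.monomial d 1

/-- The norm square `r (1 - q^r) / (1 - t^r)` of `p_r`, which is also the central charge of the
Heisenberg generator `a_r`. -/
def charge (q t : ℝ) (r : ℕ+) : ℝ := (r : ℕ) * ((1 - q ^ (r : ℕ)) / (1 - t ^ (r : ℕ)))

lemma charge_pos {q t : ℝ} (hq : q ∈ Set.Ioo (0 : ℝ) 1) (ht : t ∈ Set.Ioo (0 : ℝ) 1) (r : ℕ+) :
    0 < charge q t r := by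
  have h1 : q ^ (r : ℕ) < 1 := pow_lt_one₀ hq.1.le hq.2 r.ne_zero
  have h2 : t ^ (r : ℕ) < 1 := pow_lt_one₀ ht.1.le ht.2 r.ne_zero
  have h3 : (0 : ℝ) < (r : ℕ) := by exact_mod_cast r.pos
  exact mul_pos h3 (div_pos (by linarith) (by linarith))

lemma zWeight_eq (q t : ℝ) (d : ℕ+ →₀ ℕ) :
    zWeight q t d = d.prod fun r m => (m.factorial : ℝ) * charge q t r ^ m := by
  simp only [zWeight, charge, mul_pow, mul_assoc]

lemma zWeight_pos {q t : ℝ} (hq : q ∈ Set.Ioo (0 : ℝ) 1) (ht : t ∈ Set.Ioo (0 : ℝ) 1)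
    (d : ℕ+ →₀ ℕ) : 0 < zWeight q t d := by
  rw [zWeight_eq]
  exact Finset.prod_pos fun r _ =>
    mul_pos (by exact_mod_cast Nat.factorial_pos _) (pow_pos (charge_pos hq ht r) _)

lemma zWeight_split (q t : ℝ) (d : ℕ+ →₀ ℕ) (r : ℕ+) :
    zWeight q t d = ((d r).factorial : ℝ) * charge q t r ^ d r * zWeight q t (d.erase r) := by
  rw [zWeight_eq, zWeight_eq, Finsupp.mul_prod_erase' d r
    (fun r m => (m.factorial : ℝ) * charge q t r ^ m) (by simp)]

lemma zWeight_add_single (q t : ℝ) (d : ℕ+ →₀ ℕ) (r : ℕ+) :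
    zWeight q t (d + Finsupp.single r 1) = zWeight q t d * ((d r + 1 : ℕ) * charge q t r) := by
  have h : (d + Finsupp.single r 1).erase r = d.erase r := by
    ext i
    by_cases hi : i = r
    · simp [hi]
    · simp [Finsupp.erase_ne hi]
  rw [zWeight_split q t _ r, zWeight_split q t d r, h]
  simp only [Finsupp.add_apply, Finsupp.single_eq_same, Nat.factorial_succ, pow_succ]
  push_cast; ring

lemma pairing_eq_sum (q t : ℝ) (f g : SymFun) (s : Finset (ℕ+ →₀ ℕ)) (hs : f.support ⊆ s) :
    pairing q t f g = ∑ d ∈ s, f.coeff d * g.coeff d * zWeight q t d := by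
  refine Finset.sum_subset hs fun d _ hd => ?_
  rw [MvPolynomial.notMem_support_iff.1 hd]; ring

lemma pairing_comm (q t : ℝ) (f g : SymFun) : pairing q t f g = pairing q t g f := by
  classical
  rw [pairing_eq_sum q t f g (f.support ∪ g.support) Finset.subset_union_left,
    pairing_eq_sum q t g f (f.support ∪ g.support) Finset.subset_union_right]
  exact Finset.sum_congr rfl fun d _ => by ring

lemma pairing_add_left (q t : ℝ) (f f' g : SymFun) :
    pairing q t (f + f') g = pairing q t f g + pairing q t f' g := by
  classical
  rw [pairing_eq_sum q t _ g (f.support ∪ f'.support) MvPolynomial.support_add,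
    pairing_eq_sum q t f g _ Finset.subset_union_left,
    pairing_eq_sum q t f' g _ Finset.subset_union_right, ← Finset.sum_add_distrib]
  exact Finset.sum_congr rfl fun d _ => by rw [MvPolynomial.coeff_add]; ring

lemma pairing_smul_left (q t c : ℝ) (f g : SymFun) :
    pairing q t (c • f) g = c * pairing q t f g := by
  rw [pairing_eq_sum q t _ g f.support MvPolynomial.support_smul, pairing, Finset.mul_sum]
  exact Finset.sum_congr rfl fun d _ => by rw [MvPolynomial.coeff_smul, smul_eq_mul]; ring

/-- The Macdonald bilinear form as a bundled bilinear map. -/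
def form (q t : ℝ) : SymFun →ₗ[ℝ] SymFun →ₗ[ℝ] ℝ :=
  LinearMap.mk₂ ℝ (pairing q t) (pairing_add_left q t)
    (fun c f g => by simpa using pairing_smul_left q t c f g)
    (fun f g g' => by
      rw [pairing_comm, pairing_add_left, pairing_comm q t g, pairing_comm q t g'])
    (fun c f g => by
      rw [pairing_comm, pairing_smul_left, pairing_comm q t g, smul_eq_mul])

lemma pairing_eq_form (q t : ℝ) (f g : SymFun) : pairing q t f g = form q t f g := rfl

lemma form_comm (q t : ℝ) (f g : SymFun) : form q t f g = form q t g f := pairing_comm q t f g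

lemma form_pMon (q t : ℝ) (f : SymFun) (d : ℕ+ →₀ ℕ) :
    form q t f (pMon d) = f.coeff d * zWeight q t d := by
  rw [form_comm, ← pairing_eq_form,
    pairing_eq_sum q t _ f {d} (MvPolynomial.support_monomial_subset)]
  simp [MvPolynomial.coeff_monomial]

lemma form_pMon_pMon (q t : ℝ) (d e : ℕ+ →₀ ℕ) :
    form q t (pMon d) (pMon e) = if d = e then zWeight q t d else 0 := by
  rw [form_pMon, MvPolynomial.coeff_monomial]
  split_ifs with h <;> simp [h]

lemma form_self_pos {q t : ℝ} (hq : q ∈ Set.Ioo (0 : ℝ) 1) (ht : t ∈ Set.Ioo (0 : ℝ) 1)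
    {f : SymFun} (hf : f ≠ 0) : 0 < form q t f f :=
  Finset.sum_pos (fun d hd => mul_pos (mul_self_pos.2 (MvPolynomial.mem_support_iff.1 hd))
    (zWeight_pos hq ht d)) (MvPolynomial.support_nonempty.2 hf)

lemma linearMap_ext_pMon {M : Type*} [AddCommMonoid M] [Module ℝ M] {f g : SymFun →ₗ[ℝ] M}
    (h : ∀ d, f (pMon d) = g (pMon d)) : f = g := by
  refine (MvPolynomial.basisMonomials ℕ+ ℝ).ext fun d => ?_
  simpa using h d

/-- Multiplication by `p_r` is adjoint to a multiple of `∂/∂p_r`. -/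
lemma form_X_mul (q t : ℝ) (r : ℕ+) (f g : SymFun) :
    form q t (MvPolynomial.X r * f) g =
      charge q t r * form q t f (MvPolynomial.pderiv r g) := by
  have key : (form q t).compl₁₂ (LinearMap.mulLeft ℝ (MvPolynomial.X r : SymFun)) LinearMap.id =
      charge q t r • (form q t).compl₁₂ LinearMap.id
        (MvPolynomial.pderiv r : Derivation ℝ SymFun SymFun).toLinearMap := by
    refine linearMap_ext_pMon fun d => linearMap_ext_pMon fun e => ?_
    have hX : (MvPolynomial.X r : SymFun) * pMon d = pMon (d + Finsupp.single r 1) := by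
      rw [mul_comm, MvPolynomial.X, MvPolynomial.monomial_mul, mul_one]
    simp only [LinearMap.compl₁₂_apply, LinearMap.mulLeft_apply, hX, LinearMap.id_apply,
      LinearMap.smul_apply, Derivation.coeFn_coe,
      MvPolynomial.pderiv_monomial, smul_eq_mul, one_mul]
    have hm : (MvPolynomial.monomial (e - Finsupp.single r 1) (e r : ℝ) : SymFun) =
        (e r : ℝ) • pMon (e - Finsupp.single r 1) := by
      rw [MvPolynomial.smul_monomial, smul_eq_mul, mul_one]
    rw [hm, map_smul, form_pMon_pMon, form_pMon_pMon, smul_eq_mul]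
    by_cases h : d + Finsupp.single r 1 = e
    · subst h
      simp [zWeight_add_single]; ring
    · rw [if_neg h]
      by_cases h0 : e r = 0
      · simp [h0]
      · rw [if_neg, mul_zero, mul_zero]
        rintro rfl
        apply h
        ext i
        by_cases hi : i = r
        · subst hi; simp; omega
        · simp [Ne.symm hi]
  exact LinearMap.congr_fun (LinearMap.congr_fun key f) g

/-! ### Partitions as exponent vectors -/

lemma YSet_ext {lam mu : YSet} (h : lam.2.parts = mu.2.parts) : lam = mu := by
  obtain ⟨n, lam⟩ := lam
  obtain ⟨m, mu⟩ := mu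
  have hnm : n = m := by rw [← lam.parts_sum, ← mu.parts_sum]; exact congrArg _ h
  subst hnm
  exact congrArg _ (Nat.Partition.ext h)

lemma map_toPNat'_parts (lam : YSet) :
    (lam.2.parts.map Nat.toPNat').map (fun r : ℕ+ => (r : ℕ)) = lam.2.parts := by
  rw [Multiset.map_map]
  conv_rhs => rw [← Multiset.map_id lam.2.parts]
  refine Multiset.map_congr rfl fun i hi => ?_
  have := lam.2.parts_pos hi
  simp [Nat.toPNat'_coe, this]

/-- The multiplicities of the parts identify partitions with exponent vectors. -/
def multOf : YSet ≃ (ℕ+ →₀ ℕ) where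
  toFun lam := Multiset.toFinsupp (lam.2.parts.map Nat.toPNat')
  invFun d := ⟨(d.toMultiset.map fun r : ℕ+ => (r : ℕ)).sum,
    ⟨d.toMultiset.map fun r : ℕ+ => (r : ℕ), by
      intro i hi
      obtain ⟨r, _, rfl⟩ := Multiset.mem_map.1 hi
      exact r.pos, rfl⟩⟩
  left_inv lam := YSet_ext (by
    simp only [Multiset.toFinsupp_toMultiset]
    exact map_toPNat'_parts lam)
  right_inv d := by
    simp [Multiset.map_map]

lemma pPart_eq (lam : YSet) : pPart lam = pMon (multOf lam) := by
  have h : ∀ s : Multiset ℕ+, (s.map psym).prod = pMon (Multiset.toFinsupp s) := by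
    intro s
    induction s using Multiset.induction with
    | empty =>
      rw [Multiset.map_zero, Multiset.prod_zero, map_zero]
      exact MvPolynomial.C_1.symm
    | cons a s ih =>
      rw [Multiset.map_cons, Multiset.prod_cons, ih, psym, MvPolynomial.X,
        MvPolynomial.monomial_mul, ← Multiset.singleton_add, map_add,
        Multiset.toFinsupp_singleton, mul_one]
  rw [pPart, multOf, Equiv.coe_fn_mk, ← h, Multiset.map_map]
  rfl

lemma wt_multOf (lam : YSet) : wt (multOf lam) = lam.1 := by
  have h : ∀ s : Multiset ℕ+, wt (Multiset.toFinsupp s) = (s.map fun r : ℕ+ => (r : ℕ)).sum := by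
    intro s
    induction s using Multiset.induction with
    | empty => simp
    | cons a s ih =>
      rw [Multiset.map_cons, Multiset.sum_cons, ← ih, ← Multiset.singleton_add, map_add, map_add,
        Multiset.toFinsupp_singleton, Finsupp.weight_single, one_smul]
  rw [multOf, Equiv.coe_fn_mk, h, map_toPNat'_parts, lam.2.parts_sum]

/-! ### The degree operator and the shift of `p_1` -/

lemma degreeOp_pMon (u : ℝ) (d : ℕ+ →₀ ℕ) : degreeOp u (pMon d) = u ^ wt d • pMon d := by
  have h : pMon d = d.prod fun r m => (MvPolynomial.X r : SymFun) ^ m := by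
    rw [pMon, MvPolynomial.monomial_eq, map_one, one_mul]
  rw [degreeOp, MvPolynomial.aeval_monomial, map_one, one_mul, Finsupp.weight_apply, h,
    Finsupp.prod, Finsupp.prod, Finsupp.sum, ← Finset.prod_pow_eq_pow_sum]
  simp only [smul_pow, Finset.prod_smul, smul_eq_mul, psym, ← pow_mul, mul_comm]

lemma coeff_degreeOp (u : ℝ) (f : SymFun) (d : ℕ+ →₀ ℕ) :
    (degreeOp u f).coeff d = u ^ wt d * f.coeff d := by
  have h : MvPolynomial.lcoeff ℝ d ∘ₗ (degreeOp u).toLinearMap =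
      u ^ wt d • MvPolynomial.lcoeff ℝ d := by
    refine linearMap_ext_pMon fun e => ?_
    simp only [LinearMap.comp_apply, AlgHom.toLinearMap_apply, degreeOp_pMon, map_smul,
      LinearMap.smul_apply, MvPolynomial.lcoeff_apply, MvPolynomial.coeff_monomial]
    split_ifs with h <;> simp [h]
  exact LinearMap.congr_fun h f

lemma form_degreeOp (q t u : ℝ) (f g : SymFun) :
    form q t (degreeOp u f) g = form q t f (degreeOp u g) := by
  have h : (form q t).compl₁₂ (degreeOp u).toLinearMap LinearMap.id =
      (form q t).compl₁₂ LinearMap.id (degreeOp u).toLinearMap := by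
    refine linearMap_ext_pMon fun d => linearMap_ext_pMon fun e => ?_
    simp only [LinearMap.compl₁₂_apply, AlgHom.toLinearMap_apply, degreeOp_pMon, map_smul,
      LinearMap.smul_apply, LinearMap.id_apply, form_pMon_pMon]
    split_ifs with h <;> simp [h]
  exact LinearMap.congr_fun (LinearMap.congr_fun h f) g

/-- The shift `p_1 ↦ p_1 + ξ`, all other power sums being fixed. -/
def shift (ξ : ℝ) : SymFun →ₐ[ℝ] SymFun :=
  MvPolynomial.aeval fun r : ℕ+ => psym r + MvPolynomial.C (if r = 1 then ξ else 0)

lemma degreeOp_shift (x ξ : ℝ) (f : SymFun) :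
    degreeOp x (shift (x * ξ) f) = shift ξ (degreeOp x f) := by
  have h : (degreeOp x).comp (shift (x * ξ)) = (shift ξ).comp (degreeOp x) := by
    refine MvPolynomial.algHom_ext fun r => ?_
    simp only [AlgHom.comp_apply, shift, degreeOp, psym, MvPolynomial.aeval_X, map_add, map_smul,
      MvPolynomial.algHom_C]
    split_ifs with hr
    · subst hr; simp [MvPolynomial.smul_eq_C_mul]
    · simp
  exact DFunLike.congr_fun h f

/-! ### Homogeneous orthogonal bases -/

/-- A family of nonzero symmetric functions indexed by partitions, pairwise orthogonal for the
Macdonald form, the member of index `lam` being homogeneous of degree `|lam|`. As the degree `n`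
part has dimension the number of partitions of `n`, such a family is a basis. -/
structure IsHomOrth (q t : ℝ) (b : YSet → SymFun) : Prop where
  homog : ∀ lam d, (b lam).coeff d ≠ 0 → wt d = lam.1
  ne_zero : ∀ lam, b lam ≠ 0
  orthogonal : ∀ lam mu, lam ≠ mu → form q t (b lam) (b mu) = 0

/-- The dual family `b lam / ⟨b lam, b lam⟩` of an orthogonal family. -/
def dual (q t : ℝ) (b : YSet → SymFun) (lam : YSet) : SymFun :=
  (form q t (b lam) (b lam))⁻¹ • b lam

section

variable {q t : ℝ} {b : YSet → SymFun}

lemma IsHomOrth.norm_pos (hq : q ∈ Set.Ioo (0 : ℝ) 1) (ht : t ∈ Set.Ioo (0 : ℝ) 1)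
    (hb : IsHomOrth q t b) (lam : YSet) : 0 < form q t (b lam) (b lam) :=
  form_self_pos hq ht (hb.ne_zero lam)

lemma IsHomOrth.form_dual (hq : q ∈ Set.Ioo (0 : ℝ) 1) (ht : t ∈ Set.Ioo (0 : ℝ) 1)
    (hb : IsHomOrth q t b) (lam mu : YSet) [Decidable (lam = mu)] :
    form q t (dual q t b lam) (b mu) = if lam = mu then 1 else 0 := by
  rw [dual, map_smul, LinearMap.smul_apply, smul_eq_mul]
  split_ifs with h
  · subst h; exact inv_mul_cancel₀ (hb.norm_pos hq ht lam).ne'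
  · rw [hb.orthogonal lam mu h, mul_zero]

lemma IsHomOrth.dual (hq : q ∈ Set.Ioo (0 : ℝ) 1) (ht : t ∈ Set.Ioo (0 : ℝ) 1)
    (hb : IsHomOrth q t b) : IsHomOrth q t (dual q t b) where
  homog lam d h := hb.homog lam d fun h0 => h (by
    rw [PeriodicMacdonald.dual, MvPolynomial.coeff_smul, h0, smul_zero])
  ne_zero lam := smul_ne_zero (inv_ne_zero (hb.norm_pos hq ht lam).ne') (hb.ne_zero lam)
  orthogonal lam mu h := by
    simp [PeriodicMacdonald.dual, hb.orthogonal lam mu h]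

lemma IsHomOrth.dual_dual (hq : q ∈ Set.Ioo (0 : ℝ) 1) (ht : t ∈ Set.Ioo (0 : ℝ) 1)
    (hb : IsHomOrth q t b) : PeriodicMacdonald.dual q t (PeriodicMacdonald.dual q t b) = b := by
  funext lam
  have h := (hb.norm_pos hq ht lam).ne'
  simp only [PeriodicMacdonald.dual, map_smul, LinearMap.smul_apply, smul_eq_mul, smul_smul]
  field_simp
  simp

lemma IsHomOrth.degreeOp_apply (hb : IsHomOrth q t b) (u : ℝ) (lam : YSet) :
    degreeOp u (b lam) = u ^ lam.1 • b lam := by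
  ext d
  rw [coeff_degreeOp, MvPolynomial.coeff_smul, smul_eq_mul]
  by_cases h : (b lam).coeff d = 0
  · simp [h]
  · rw [hb.homog lam d h]

lemma isHomOrth_pPart : IsHomOrth q t pPart where
  homog lam d h := by
    rw [pPart_eq, MvPolynomial.coeff_monomial] at h
    have : multOf lam = d := by by_contra h'; simp [h'] at h
    rw [← this, wt_multOf]
  ne_zero lam := by simp [pPart_eq]
  orthogonal lam mu h := by
    rw [pPart_eq, pPart_eq, form_pMon_pMon, if_neg fun h' => h (multOf.injective h')]

lemma IsHomOrth.expand (hb : IsHomOrth q t b) {n : ℕ} (lam : n.Partition) :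
    b ⟨n, lam⟩ = ∑ mu : n.Partition,
      (b ⟨n, lam⟩).coeff (multOf ⟨n, mu⟩) • pMon (multOf ⟨n, mu⟩) := by
  ext d
  obtain ⟨⟨m, nu⟩, rfl⟩ := multOf.surjective d
  simp only [MvPolynomial.coeff_sum, MvPolynomial.coeff_smul, MvPolynomial.coeff_monomial,
    multOf.injective.eq_iff, smul_eq_mul, mul_ite, mul_one, mul_zero]
  by_cases h : n = m
  · subst h
    rw [Finset.sum_eq_single nu] <;> simp +contextual
  · rw [Finset.sum_eq_zero fun mu _ => if_neg fun h' => h (congrArg Sigma.fst h')]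
    by_contra h0
    have := hb.homog _ _ h0
    rw [wt_multOf] at this
    exact h this.symm

/-- In each degree, the canonical tensor `∑ b ⊗ b^*` is the same for every homogeneous orthogonal
family: the matrix from the power sums to `b` has a one-sided inverse by orthogonality, which is
then two-sided because both index sets are the partitions of `n`. -/
lemma IsHomOrth.sum_dual (hq : q ∈ Set.Ioo (0 : ℝ) 1) (ht : t ∈ Set.Ioo (0 : ℝ) 1)
    (hb : IsHomOrth q t b) {M : Type*} [AddCommGroup M] [Module ℝ M]
    (Φ : SymFun →ₗ[ℝ] SymFun →ₗ[ℝ] M) (n : ℕ) :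
    ∑ lam : n.Partition, Φ (b ⟨n, lam⟩) (PeriodicMacdonald.dual q t b ⟨n, lam⟩) =
      ∑ mu : n.Partition, (zWeight q t (multOf ⟨n, mu⟩))⁻¹ •
        Φ (pMon (multOf ⟨n, mu⟩)) (pMon (multOf ⟨n, mu⟩)) := by
  classical
  let z : n.Partition → ℝ := fun mu => zWeight q t (multOf ⟨n, mu⟩)
  let p : n.Partition → SymFun := fun mu => pMon (multOf ⟨n, mu⟩)
  let A : Matrix n.Partition n.Partition ℝ := fun lam mu => (b ⟨n, lam⟩).coeff (multOf ⟨n, mu⟩)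
  let N : n.Partition → ℝ := fun lam => form q t (b ⟨n, lam⟩) (b ⟨n, lam⟩)
  let B : Matrix n.Partition n.Partition ℝ := fun mu lam => z mu * A lam mu * (N lam)⁻¹
  have hz : ∀ mu, z mu ≠ 0 := fun mu => (zWeight_pos hq ht _).ne'
  have hexp : ∀ lam, b ⟨n, lam⟩ = ∑ mu, A lam mu • p mu := fun lam => hb.expand lam
  have hform : ∀ lam lam', form q t (b ⟨n, lam⟩) (b ⟨n, lam'⟩) =
      ∑ mu, A lam mu * (z mu * A lam' mu) := by
    intro lam lam'
    conv_lhs => rw [hexp lam']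
    rw [map_sum]
    refine Finset.sum_congr rfl fun mu _ => ?_
    rw [map_smul, form_pMon, smul_eq_mul]
    ring
  have hAB : A * B = 1 := by
    ext lam lam'
    rw [Matrix.mul_apply, Matrix.one_apply]
    have h1 : ∑ mu, A lam mu * B mu lam' =
        form q t (b ⟨n, lam⟩) (b ⟨n, lam'⟩) * (N lam')⁻¹ := by
      rw [hform, Finset.sum_mul]
      exact Finset.sum_congr rfl fun mu _ => by simp only [B]; ring
    rw [h1]
    split_ifs with h
    · subst h; exact mul_inv_cancel₀ (hb.norm_pos hq ht _).ne'
    · rw [hb.orthogonal _ _ (fun h' => h (by simpa using h')), zero_mul]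
  have hBA : B * A = 1 := mul_eq_one_comm.1 hAB
  have hsum : ∀ mu nu, ∑ lam, (N lam)⁻¹ * (A lam nu * A lam mu) =
      if mu = nu then (z mu)⁻¹ else 0 := by
    intro mu nu
    have h := congrFun (congrFun hBA mu) nu
    rw [Matrix.mul_apply, Matrix.one_apply] at h
    have h2 : z mu * ∑ lam, (N lam)⁻¹ * (A lam nu * A lam mu) = if mu = nu then 1 else 0 := by
      rw [← h, Finset.mul_sum]
      exact Finset.sum_congr rfl fun lam _ => by simp only [B]; ring
    rw [← inv_mul_cancel_left₀ (hz mu) (∑ lam, (N lam)⁻¹ * (A lam nu * A lam mu)), h2]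
    split_ifs <;> simp
  have hterm : ∀ lam : n.Partition,
      Φ (b ⟨n, lam⟩) (PeriodicMacdonald.dual q t b ⟨n, lam⟩) =
        ∑ mu, ∑ nu, ((N lam)⁻¹ * (A lam nu * A lam mu)) • Φ (p mu) (p nu) := by
    intro lam
    rw [PeriodicMacdonald.dual, map_smul]
    change (N lam)⁻¹ • _ = _
    rw [hexp lam]
    simp only [map_sum, map_smul, LinearMap.sum_apply, LinearMap.smul_apply, Finset.smul_sum,
      smul_smul]
    exact Finset.sum_comm
  rw [Finset.sum_congr rfl fun lam _ => hterm lam, Finset.sum_comm]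
  refine Finset.sum_congr rfl fun mu _ => ?_
  rw [Finset.sum_comm]
  simp only [← Finset.sum_smul, hsum]
  simp [z, p]

lemma IsHomOrth.linearIndependent (hq : q ∈ Set.Ioo (0 : ℝ) 1) (ht : t ∈ Set.Ioo (0 : ℝ) 1)
    (hb : IsHomOrth q t b) : LinearIndependent ℝ b := by
  classical
  refine linearIndependent_iff'.2 fun s g hg lam hlam => ?_
  have h := congrArg (form q t (PeriodicMacdonald.dual q t b lam)) hg
  simpa [hb.form_dual hq ht, hlam] using h

lemma IsHomOrth.span_eq_top (hq : q ∈ Set.Ioo (0 : ℝ) 1) (ht : t ∈ Set.Ioo (0 : ℝ) 1)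
    (hb : IsHomOrth q t b) : ⊤ ≤ Submodule.span ℝ (Set.range b) := by
  classical
  have hp : ∀ d, pMon d ∈ Submodule.span ℝ (Set.range b) := by
    intro d
    obtain ⟨⟨n, mu⟩, rfl⟩ := multOf.surjective d
    have h := hb.sum_dual hq ht
      ((LinearMap.lsmul ℝ SymFun).comp (form q t (pMon (multOf ⟨n, mu⟩)))) n
    simp only [LinearMap.comp_apply, form_pMon_pMon, LinearMap.lsmul_apply] at h
    have h2 : ∀ f : n.Partition → SymFun, ∑ nu, (zWeight q t (multOf ⟨n, nu⟩))⁻¹ •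
        (if multOf ⟨n, mu⟩ = multOf ⟨n, nu⟩ then zWeight q t (multOf ⟨n, mu⟩) else 0) • f nu =
          f mu := by
      intro f
      rw [Finset.sum_eq_single mu (fun nu _ hnu => by
          rw [if_neg fun h' => hnu (by simpa using (multOf.injective h').symm), zero_smul,
            smul_zero]) (by simp), if_pos rfl, smul_smul,
        inv_mul_cancel₀ (zWeight_pos hq ht _).ne', one_smul]
    rw [h2] at h
    rw [← h]
    exact Submodule.sum_mem _ fun lam _ => Submodule.smul_mem _ _
      (Submodule.smul_mem _ _ (Submodule.subset_span ⟨_, rfl⟩))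
  intro f _
  rw [← MvPolynomial.support_sum_monomial_coeff f]
  refine Submodule.sum_mem _ fun d _ => ?_
  have : MvPolynomial.monomial d (f.coeff d) = f.coeff d • pMon d := by
    rw [MvPolynomial.smul_monomial, smul_eq_mul, mul_one]
  rw [this]
  exact Submodule.smul_mem _ _ (hp d)

lemma IsHomOrth.expansionCoeff_eq (hq : q ∈ Set.Ioo (0 : ℝ) 1) (ht : t ∈ Set.Ioo (0 : ℝ) 1)
    (hb : IsHomOrth q t b) (mu : YSet) (f : SymFun) :
    expansionCoeff b mu f = form q t (PeriodicMacdonald.dual q t b mu) f := by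
  classical
  rw [expansionCoeff, dif_pos ⟨hb.linearIndependent hq ht, hb.span_eq_top hq ht⟩]
  have h : (Module.Basis.mk (hb.linearIndependent hq ht) (hb.span_eq_top hq ht)).coord mu =
      form q t (PeriodicMacdonald.dual q t b mu) := by
    refine (Module.Basis.mk (hb.linearIndependent hq ht) (hb.span_eq_top hq ht)).ext fun lam => ?_
    rw [Module.Basis.mk_apply, hb.form_dual hq ht, Module.Basis.mk_coord_apply]
    simp [eq_comm]
  rw [h]

/-! ### Summation over a homogeneous orthogonal basis -/

lemma IsHomOrth.summable_dual (hq : q ∈ Set.Ioo (0 : ℝ) 1) (ht : t ∈ Set.Ioo (0 : ℝ) 1)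
    (hb : IsHomOrth q t b) (Φ : SymFun →ₗ[ℝ] SymFun →ₗ[ℝ] ℝ) (hΦ : ∀ f, 0 ≤ Φ f f)
    (hs : Summable fun d => (zWeight q t d)⁻¹ * Φ (pMon d) (pMon d)) :
    Summable fun lam => Φ (b lam) (PeriodicMacdonald.dual q t b lam) := by
  have h1 : ∀ lam, 0 ≤ Φ (b lam) (PeriodicMacdonald.dual q t b lam) := fun lam => by
    rw [PeriodicMacdonald.dual, map_smul]
    exact mul_nonneg (inv_nonneg.2 (hb.norm_pos hq ht lam).le) (hΦ _)
  have hs' := (multOf.summable_iff.2 hs).sigma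
  refine (summable_sigma_of_nonneg h1).2 ⟨fun n => (hasSum_fintype _).summable, ?_⟩
  refine hs'.congr fun n => ?_
  rw [tsum_fintype, tsum_fintype, hb.sum_dual hq ht Φ n]
  rfl

/-- Parseval's identity: if two functionals are square summable on the normalized power-sum
monomials, then the sum of their products over the basis `b` and its dual can be computed on
these monomials. -/
lemma IsHomOrth.hasSum_dual (hq : q ∈ Set.Ioo (0 : ℝ) 1) (ht : t ∈ Set.Ioo (0 : ℝ) 1)
    (hb : IsHomOrth q t b) (f g : SymFun →ₗ[ℝ] ℝ) {S : ℝ}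
    (hf : Summable fun d => (zWeight q t d)⁻¹ * (f (pMon d) * f (pMon d)))
    (hg : Summable fun d => (zWeight q t d)⁻¹ * (g (pMon d) * g (pMon d)))
    (hS : HasSum (fun d => (zWeight q t d)⁻¹ * (f (pMon d) * g (pMon d))) S) :
    HasSum (fun lam => f (b lam) * g (PeriodicMacdonald.dual q t b lam)) S := by
  have hff := hb.summable_dual hq ht ((LinearMap.mul ℝ ℝ).compl₁₂ f f)
    (fun x => mul_self_nonneg _) hf
  have hgg := hb.summable_dual hq ht ((LinearMap.mul ℝ ℝ).compl₁₂ g g)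
    (fun x => mul_self_nonneg _) hg
  have hsum : Summable fun lam => f (b lam) * g (PeriodicMacdonald.dual q t b lam) := by
    refine Summable.of_norm_bounded (hff.add hgg) fun lam => ?_
    have hN := hb.norm_pos hq ht lam
    simp only [LinearMap.compl₁₂_apply, LinearMap.mul_apply', PeriodicMacdonald.dual, map_smul,
      smul_eq_mul]
    have h2 : |f (b lam) * g (b lam)| ≤ f (b lam) * f (b lam) + g (b lam) * g (b lam) := by
      rw [abs_le]
      constructor <;> nlinarith [sq_nonneg (f (b lam) + g (b lam)),
        sq_nonneg (f (b lam) - g (b lam)), sq_nonneg (f (b lam)), sq_nonneg (g (b lam))]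
    rw [Real.norm_eq_abs, mul_left_comm, abs_mul, abs_of_pos (inv_pos.2 hN)]
    calc _ ≤ (form q t (b lam) (b lam))⁻¹ * (f (b lam) * f (b lam) + g (b lam) * g (b lam)) := by
          gcongr
      _ = _ := by ring
  have h1 := (multOf.hasSum_iff.2 hS).sigma fun n => hasSum_fintype _
  have h2 := hsum.hasSum.sigma fun n => hasSum_fintype _
  have h3 : ∀ n : ℕ, ∑ lam : n.Partition, f (b ⟨n, lam⟩) *
      g (PeriodicMacdonald.dual q t b ⟨n, lam⟩) = _ := fun n =>
    hb.sum_dual hq ht ((LinearMap.mul ℝ ℝ).compl₁₂ f g) n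
  simp only [h3] at h2
  rw [h1.unique h2]
  exact hsum.hasSum

end

/-! ### Algebraic independence of the power sums -/

/-- A surjective endomorphism of a Noetherian ring is injective: the kernels of its powers
stabilize. -/
lemma injective_of_surjective_of_isNoetherianRing {A : Type*} [CommRing A] [IsNoetherianRing A]
    (f : A →+* A) (hf : Function.Surjective f) : Function.Injective f := by
  have hsucc : ∀ n x, (f ^ (n + 1)) x = (f ^ n) (f x) := fun n x => by
    rw [pow_succ]; rfl
  have hsucc' : ∀ n x, (f ^ (n + 1)) x = f ((f ^ n) x) := fun n x => by
    rw [pow_succ']; rfl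
  have hmono : Monotone fun n => RingHom.ker (f ^ n) :=
    monotone_nat_of_le_succ fun n x hx => by
      rw [RingHom.mem_ker] at hx ⊢
      rw [hsucc', hx, map_zero]
  obtain ⟨n, hn⟩ := monotone_stabilizes_iff_noetherian.2 ‹IsNoetherianRing A› ⟨_, hmono⟩
  have hsurj : Function.Surjective (f ^ n) := by
    clear hn
    induction n with
    | zero => exact fun x => ⟨x, rfl⟩
    | succ n ih =>
      intro x
      obtain ⟨y, rfl⟩ := ih x
      obtain ⟨z, rfl⟩ := hf y
      exact ⟨z, hsucc n z⟩
  refine (injective_iff_map_eq_zero f).2 fun x hx => ?_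
  obtain ⟨y, rfl⟩ := hsurj x
  have h1 : y ∈ RingHom.ker (f ^ (n + 1)) := by rw [RingHom.mem_ker, hsucc', hx]
  have h2 : RingHom.ker (f ^ n) = RingHom.ker (f ^ (n + 1)) := hn (n + 1) n.le_succ
  rw [← h2] at h1
  exact h1

open MvPolynomial in
/-- The power sums `p_1, …, p_k` in `k` variables are algebraically independent. By Newton's
identities they generate the symmetric polynomials, which form a polynomial ring in `k` variables;
so they define a surjective endomorphism of the latter. -/
lemma aeval_psum_injective (k : ℕ) :
    Function.Injective (aeval (R := ℝ) fun i : Fin k => psum (Fin k) ℝ (i + 1)) := by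
  let S := symmetricSubalgebra (Fin k) ℝ
  let ψ : MvPolynomial (Fin k) ℝ →ₐ[ℝ] S :=
    aeval fun i : Fin k => ⟨psum (Fin k) ℝ (i + 1), psum_isSymmetric _ _ _⟩
  have hp : ∀ j, 0 < j → j ≤ k → (⟨psum (Fin k) ℝ j, psum_isSymmetric _ _ _⟩ : S) ∈ ψ.range := by
    intro j h0 hj
    obtain ⟨i, rfl⟩ : ∃ i, j = i + 1 := ⟨j - 1, by omega⟩
    exact ⟨X ⟨i, hj⟩, by simp [ψ]⟩
  have he : ∀ j, j ≤ k → (⟨esymm (Fin k) ℝ j, esymm_isSymmetric _ _ _⟩ : S) ∈ ψ.range := by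
    intro j
    induction j using Nat.strong_induction_on with
    | _ j ih =>
      intro hj
      rcases Nat.eq_zero_or_pos j with rfl | h0
      · convert ψ.range.one_mem
        exact Subtype.ext (esymm_zero (Fin k) ℝ)
      · have hj0 : (j : ℝ) ≠ 0 := by exact_mod_cast h0.ne'
        have hN : (⟨esymm (Fin k) ℝ j, esymm_isSymmetric _ _ _⟩ : S) = (j : ℝ)⁻¹ •
            ((-1) ^ (j + 1) * ∑ a ∈ Finset.HasAntidiagonal.antidiagonal j with a.1 < j, (-1) ^ a.1 *
              (⟨esymm (Fin k) ℝ a.1, esymm_isSymmetric _ _ _⟩ : S) *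
                ⟨psum (Fin k) ℝ a.2, psum_isSymmetric _ _ _⟩) := by
          rw [eq_inv_smul_iff₀ hj0]
          apply Subtype.ext
          have := mul_esymm_eq_sum (Fin k) ℝ j
          push_cast
          rw [← this, MvPolynomial.smul_eq_C_mul]
          simp
        rw [hN]
        refine Subalgebra.smul_mem _
          (Subalgebra.mul_mem _ ?_ (Subalgebra.sum_mem _ fun a ha => ?_)) _
        · exact Subalgebra.pow_mem _ (Subalgebra.neg_mem _ (Subalgebra.one_mem _)) _
        · rw [Finset.mem_filter, Finset.HasAntidiagonal.mem_antidiagonal] at ha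
          refine Subalgebra.mul_mem _ (Subalgebra.mul_mem _
            (Subalgebra.pow_mem _ (Subalgebra.neg_mem _ (Subalgebra.one_mem _)) _)
            (ih _ ha.2 (by omega))) (hp _ (by omega) (by omega))
  have hψ : Function.Surjective ψ := by
    intro x
    obtain ⟨y, rfl⟩ := esymmAlgHom_surjective (σ := Fin k) (n := k) ℝ (by simp) x
    change _ ∈ ψ.range
    induction y using MvPolynomial.induction_on with
    | C r => rw [← algebraMap_eq, AlgHom.commutes]; apply Subalgebra.algebraMap_mem
    | add p q hp hq => rw [map_add]; exact Subalgebra.add_mem _ hp hq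
    | mul_X p i hp =>
      rw [map_mul]
      refine Subalgebra.mul_mem _ hp ?_
      rw [esymmAlgHom, aeval_X]
      exact he _ i.2
  let e := esymmAlgEquiv (Fin k) (R := ℝ) (n := k) (by simp)
  have hinj := injective_of_surjective_of_isNoetherianRing
    ((e.symm.toAlgHom.comp ψ : MvPolynomial (Fin k) ℝ →ₐ[ℝ] MvPolynomial (Fin k) ℝ) :
      MvPolynomial (Fin k) ℝ →+* MvPolynomial (Fin k) ℝ) (e.symm.surjective.comp hψ)
  have hψinj : Function.Injective ψ := fun x y hxy => hinj (congrArg e.symm hxy)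
  have hval : (aeval (R := ℝ) fun i : Fin k => psum (Fin k) ℝ (i + 1)) = S.val.comp ψ :=
    MvPolynomial.algHom_ext fun i => by simp [ψ]
  rw [hval]
  exact Subtype.val_injective.comp hψinj

/-- A symmetric function is determined by its reductions to finitely many variables. -/
lemma eq_zero_of_reduction_eq_zero (f : SymFun) (h : ∀ k, reduction k f = 0) : f = 0 := by
  classical
  obtain ⟨k, hk⟩ : ∃ k : ℕ, ∀ r ∈ f.vars, (r : ℕ) ≤ k :=
    ⟨f.vars.sup fun r : ℕ+ => (r : ℕ), fun r hr => Finset.le_sup (f := fun r : ℕ+ => (r : ℕ)) hr⟩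
  let ι : Fin k → ℕ+ := fun i => Nat.succPNat i
  have hι : Function.Injective ι := fun i j hij => Fin.ext (Nat.succPNat_injective hij)
  obtain ⟨g, rfl⟩ := MvPolynomial.exists_rename_eq_of_vars_subset_range f ι hι fun r hr =>
    ⟨⟨(r : ℕ) - 1, by have := hk r hr; have := r.pos; omega⟩, by
      apply PNat.eq
      simp only [ι, Nat.succPNat_coe]
      have := r.pos; omega⟩
  have h1 := h k
  rw [reduction, MvPolynomial.aeval_rename] at h1
  have h2 : g = 0 := aeval_psum_injective k (by rw [map_zero, ← h1]; rfl)
  rw [h2, map_zero]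

/-! ### Macdonald functions form a homogeneous orthogonal basis -/

lemma reduction_degreeOp (k : ℕ) (u : ℝ) (f : SymFun) :
    reduction k (degreeOp u f) =
      MvPolynomial.aeval (fun i : Fin k => u • (MvPolynomial.X i : MvPolynomial (Fin k) ℝ))
        (reduction k f) := by
  have h : (reduction k).comp (degreeOp u) = (MvPolynomial.aeval
      (fun i : Fin k => u • (MvPolynomial.X i : MvPolynomial (Fin k) ℝ))).comp (reduction k) := by
    refine MvPolynomial.algHom_ext fun r => ?_
    simp [reduction, degreeOp, psym, MvPolynomial.psum, smul_pow, Finset.smul_sum]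
  exact DFunLike.congr_fun h f

lemma aeval_smul_msymm (k : ℕ) (u : ℝ) {n : ℕ} (mu : n.Partition) :
    MvPolynomial.aeval (fun i : Fin k => u • (MvPolynomial.X i : MvPolynomial (Fin k) ℝ))
      (MvPolynomial.msymm (Fin k) ℝ mu) = u ^ n • MvPolynomial.msymm (Fin k) ℝ mu := by
  rw [MvPolynomial.msymm, map_sum, Finset.smul_sum]
  refine Finset.sum_congr rfl fun s _ => ?_
  rw [map_multiset_prod, Multiset.map_map]
  have : ∀ m : Multiset (Fin k), (m.map ((MvPolynomial.aeval (fun i : Fin k =>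
      u • (MvPolynomial.X i : MvPolynomial (Fin k) ℝ))) ∘ MvPolynomial.X (R := ℝ))).prod =
      u ^ m.card • (m.map (MvPolynomial.X (R := ℝ))).prod := by
    intro m
    induction m using Multiset.induction with
    | empty => simp
    | cons a m ih =>
      rw [Multiset.map_cons, Multiset.prod_cons, ih, Function.comp_apply, MvPolynomial.aeval_X,
        Multiset.map_cons, Multiset.prod_cons, Multiset.card_cons, pow_succ', smul_mul_smul_comm]
  rw [this, s.1.2]

lemma coeff_msymm (k : ℕ) {n : ℕ} (mu : n.Partition) (a : Sym (Fin k) n) :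
    (MvPolynomial.msymm (Fin k) ℝ mu).coeff (Multiset.toFinsupp (a : Multiset (Fin k))) =
      if Nat.Partition.ofSym a = mu then 1 else 0 := by
  have hX : ∀ m : Multiset (Fin k), (m.map (MvPolynomial.X (R := ℝ))).prod =
      MvPolynomial.monomial (Multiset.toFinsupp m) 1 := by
    intro m
    induction m using Multiset.induction with
    | empty =>
      rw [Multiset.map_zero, Multiset.prod_zero, map_zero]
      exact MvPolynomial.C_1.symm
    | cons a m ih =>
      rw [Multiset.map_cons, Multiset.prod_cons, ih, MvPolynomial.X,
        MvPolynomial.monomial_mul, ← Multiset.singleton_add, map_add,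
        Multiset.toFinsupp_singleton, mul_one]
  rw [MvPolynomial.msymm, MvPolynomial.coeff_sum]
  simp only [hX, MvPolynomial.coeff_monomial, EmbeddingLike.apply_eq_iff_eq]
  split_ifs with h
  · rw [Finset.sum_eq_single ⟨a, h⟩]
    · exact if_pos rfl
    · intro s _ hs
      exact if_neg fun h' => hs (Subtype.ext (Subtype.ext h'))
    · simp
  · refine Finset.sum_eq_zero fun s _ => if_neg fun h' => h ?_
    have : s.1 = a := Subtype.ext h'
    rw [← this, s.2]

/-- Every partition is the exponent pattern of a monomial in as many variables as it has parts. -/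
lemma exists_ofSym_eq {n : ℕ} (lam : n.Partition) :
    ∃ (k : ℕ) (a : Sym (Fin k) n), Nat.Partition.ofSym a = lam := by
  classical
  let l := lam.parts.toList
  let D : Fin l.length →₀ ℕ := Finsupp.equivFunOnFinite.symm l.get
  have hpos : ∀ i, D i ≠ 0 := fun i =>
    (lam.parts_pos (Multiset.mem_toList.1 (l.get_mem i))).ne'
  have hl : (Finset.univ.val.map l.get : Multiset ℕ) = lam.parts := by
    rw [Fin.univ_val_map, List.ofFn_get, Multiset.coe_toList]
  have hcard : (Finsupp.toMultiset D).card = n := by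
    rw [Finsupp.card_toMultiset, Finsupp.sum_fintype _ _ (fun _ => rfl)]
    rw [← lam.parts_sum, ← hl]; rfl
  refine ⟨l.length, ⟨Finsupp.toMultiset D, hcard⟩, Nat.Partition.ext ?_⟩
  change (Finsupp.toMultiset D).dedup.map (fun i => (Finsupp.toMultiset D).count i) = _
  have hd : (Finsupp.toMultiset D).dedup = Finset.univ.val := by
    change (Finsupp.toMultiset D).toFinset.val = _
    congr 1
    rw [Finsupp.toFinset_toMultiset]
    ext i; simp [hpos i]
  rw [hd]
  simp only [Finsupp.count_toMultiset]
  exact hl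

/-- Homogeneity holds because `2^D` acts on all monomial symmetric functions of a given degree by
the same scalar, and `P_lam` is nonzero because `m_lam` occurs in it with coefficient one. -/
lemma IsMacdonaldFamily.isHomOrth {q t : ℝ} {P : YSet → SymFun} (hP : IsMacdonaldFamily q t P) :
    IsHomOrth q t P where
  homog lam d hd := by
    obtain ⟨c, -, hc⟩ := hP.triangular lam
    have h : degreeOp 2 (P lam) - (2 : ℝ) ^ lam.1 • P lam = 0 := by
      refine eq_zero_of_reduction_eq_zero _ fun k => ?_
      rw [map_sub, map_smul, reduction_degreeOp, hc k]
      simp only [map_add, map_sum, map_smul, aeval_smul_msymm, smul_add, Finset.smul_sum]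
      rw [sub_eq_zero]
      exact congrArg _ (Finset.sum_congr rfl fun mu _ => smul_comm _ _ _)
    have h2 := congrArg (MvPolynomial.coeff d) h
    rw [MvPolynomial.coeff_sub, coeff_degreeOp, MvPolynomial.coeff_smul, smul_eq_mul,
      ← sub_mul, MvPolynomial.coeff_zero, mul_eq_zero, or_iff_left hd, sub_eq_zero] at h2
    exact pow_right_injective₀ (by norm_num) (by norm_num) h2
  ne_zero lam h0 := by
    obtain ⟨c, hdom, hc⟩ := hP.triangular lam
    obtain ⟨k, a, ha⟩ := exists_ofSym_eq lam.2
    have h := congrArg (MvPolynomial.coeff (Multiset.toFinsupp (a : Multiset (Fin k)))) (hc k)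
    rw [h0, map_zero, MvPolynomial.coeff_zero, MvPolynomial.coeff_add, MvPolynomial.coeff_sum,
      coeff_msymm, if_pos ha, Finset.sum_eq_zero, add_zero] at h
    · exact zero_ne_one h
    · intro mu _
      rw [MvPolynomial.coeff_smul, coeff_msymm, ha, smul_eq_mul]
      by_cases hmu : lam.2 = mu
      · have : c mu = 0 := by
          by_contra hne
          exact (hdom mu hne).1 hmu.symm
        rw [this, zero_mul]
      · rw [if_neg hmu, mul_zero]
  orthogonal := hP.orthogonal

/-- No appeal to the existence of the Macdonald family is needed: the power sums, to which `macP`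
falls back otherwise, are a homogeneous orthogonal family as well. -/
lemma isHomOrth_macP (q t : ℝ) : IsHomOrth q t (macP q t) := by
  rw [macP]
  split_ifs with h
  · exact h.choose_spec.isHomOrth
  · exact isHomOrth_pPart

/-! ### Vertex operators of Plancherel specializations -/

lemma shift_X (ξ : ℝ) (r : ℕ+) : shift ξ (MvPolynomial.X r) =
    MvPolynomial.X r + MvPolynomial.C (if r = 1 then ξ else 0) := by
  rw [shift, MvPolynomial.aeval_X, psym]

lemma shift_pMon (ξ : ℝ) (d : ℕ+ →₀ ℕ) :
    shift ξ (pMon d) = ∑ k ∈ Finset.range (d 1 + 1),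
      (((d 1).choose k : ℝ) * ξ ^ k) • pMon (d - Finsupp.single 1 k) := by
  have hd : d = d.erase 1 + Finsupp.single 1 (d 1) := (Finsupp.erase_add_single 1 d).symm
  have hmul : ∀ m, pMon (d.erase 1 + Finsupp.single 1 m) =
      pMon (d.erase 1) * (MvPolynomial.X 1 : SymFun) ^ m := fun m => by
    rw [MvPolynomial.X_pow_eq_monomial, MvPolynomial.monomial_mul, mul_one]
  have h1 : shift ξ (pMon (d.erase 1)) = pMon (d.erase 1) := by
    have h : pMon (d.erase 1) = (d.erase 1).prod fun r m => (MvPolynomial.X r : SymFun) ^ m := by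
      rw [pMon, MvPolynomial.monomial_eq, map_one, one_mul]
    rw [h, Finsupp.prod, map_prod]
    refine Finset.prod_congr rfl fun r hr => ?_
    have hr1 : r ≠ 1 := by rintro rfl; simp at hr
    rw [map_pow, shift_X, if_neg hr1, map_zero, add_zero]
  conv_lhs => rw [hd, hmul, map_mul, map_pow, h1, shift_X, if_pos rfl, add_comm, add_pow,
    Finset.mul_sum]
  refine Finset.sum_congr rfl fun k hk => ?_
  have hsub : d - Finsupp.single 1 k = d.erase 1 + Finsupp.single 1 (d 1 - k) := by
    ext r
    by_cases hr : r = 1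
    · subst hr; simp
    · simp [hr, Finsupp.erase_ne]
  rw [hsub, hmul, MvPolynomial.smul_eq_C_mul, map_mul, map_pow, map_natCast]
  ring

lemma iterate_pderiv_pMon (d : ℕ+ →₀ ℕ) (k : ℕ) :
    (MvPolynomial.pderiv (1 : ℕ+) : SymFun → SymFun)^[k] (pMon d) =
      ((d 1).descFactorial k : ℝ) • pMon (d - Finsupp.single 1 k) := by
  induction k with
  | zero => simp
  | succ k ih =>
    rw [Function.iterate_succ_apply', ih, Derivation.map_smul, MvPolynomial.pderiv_monomial,
      tsub_tsub, ← Finsupp.single_add, MvPolynomial.smul_monomial, MvPolynomial.smul_monomial,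
      Nat.descFactorial_succ]
    congr 1
    simp [mul_comm]

lemma iterate_smul_pderiv (ξ : ℝ) (k : ℕ) (v : SymFun) :
    (fun w : SymFun => ξ • MvPolynomial.pderiv (1 : ℕ+) w)^[k] v =
      ξ ^ k • (MvPolynomial.pderiv (1 : ℕ+) : SymFun → SymFun)^[k] v := by
  induction k with
  | zero => simp
  | succ k ih =>
    rw [Function.iterate_succ_apply', ih, Function.iterate_succ_apply', Derivation.map_smul,
      smul_smul, pow_succ']

/-- Taylor's formula `exp (ξ ∂/∂p_1) f = f(p_1 + ξ)`. -/
lemma finsum_iterate_pderiv (ξ : ℝ) (v : SymFun) :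
    ∑ᶠ k : ℕ, ((k.factorial : ℝ)⁻¹) •
      (fun w : SymFun => ξ • MvPolynomial.pderiv (1 : ℕ+) w)^[k] v = shift ξ v := by
  let E : ℕ → SymFun →ₗ[ℝ] SymFun := fun k => ((k.factorial : ℝ)⁻¹ * ξ ^ k) •
    ((MvPolynomial.pderiv (1 : ℕ+) : Derivation ℝ SymFun SymFun).toLinearMap ^ k)
  have hE : ∀ k v, E k v = ((k.factorial : ℝ)⁻¹) •
      (fun w : SymFun => ξ • MvPolynomial.pderiv (1 : ℕ+) w)^[k] v := fun k v => by
    rw [iterate_smul_pderiv, smul_smul, LinearMap.smul_apply, Module.End.pow_apply]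
    rfl
  have hmon : ∀ d k, E k (pMon d) = (((d 1).choose k : ℝ) * ξ ^ k) •
      pMon (d - Finsupp.single 1 k) := fun d k => by
    have hk : (k.factorial : ℝ) ≠ 0 := by exact_mod_cast k.factorial_ne_zero
    rw [hE, iterate_smul_pderiv, iterate_pderiv_pMon, smul_smul, smul_smul,
      Nat.descFactorial_eq_factorial_mul_choose]
    congr 1
    push_cast
    field_simp
  have key : ∀ v : SymFun, ∃ N, (∀ k, N ≤ k → E k v = 0) ∧
      ∑ k ∈ Finset.range N, E k v = shift ξ v := by
    intro v
    induction v using MvPolynomial.induction_on' with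
    | monomial d c =>
      have hc : MvPolynomial.monomial d c = c • pMon d := by
        rw [MvPolynomial.smul_monomial, smul_eq_mul, mul_one]
      refine ⟨d 1 + 1, fun k hk => ?_, ?_⟩
      · rw [hc, map_smul, hmon, Nat.choose_eq_zero_of_lt hk]; simp
      · rw [hc, map_smul, shift_pMon, Finset.smul_sum]
        exact Finset.sum_congr rfl fun k _ => by rw [map_smul, hmon]
    | add f g hf hg =>
      obtain ⟨N, hN, hNs⟩ := hf
      obtain ⟨M, hM, hMs⟩ := hg
      refine ⟨max N M, fun k hk => ?_, ?_⟩
      · rw [map_add, hN k (le_trans (le_max_left _ _) hk),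
          hM k (le_trans (le_max_right _ _) hk), add_zero]
      · simp only [map_add, Finset.sum_add_distrib]
        congr 1
        · rw [← hNs]
          refine (Finset.sum_subset (Finset.range_mono (le_max_left _ _)) fun k _ hk => ?_).symm
          exact hN k (by simpa using hk)
        · rw [← hMs]
          refine (Finset.sum_subset (Finset.range_mono (le_max_right _ _)) fun k _ hk => ?_).symm
          exact hM k (by simpa using hk)
  obtain ⟨N, hN, hNs⟩ := key v
  rw [← hNs]
  simp only [← hE]
  refine finsum_eq_sum_of_support_subset _ fun k hk => ?_
  by_contra h
  exact hk (hN k (by simpa using h))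

lemma gammaPlusKet_plancherel {q t : ℝ} (hq : q ∈ Set.Ioo (0 : ℝ) 1) (ht : t ∈ Set.Ioo (0 : ℝ) 1)
    (ξ : ℝ) (v : SymFun) : gammaPlusKet q t (plancherel ξ) v = shift ξ v := by
  rw [gammaPlusKet, vertexExp, ← finsum_iterate_pderiv]
  have h : (fun w : SymFun => ∑ᶠ n : ℕ+, ((1 - t ^ (n : ℕ)) / (1 - q ^ (n : ℕ)) *
      (plancherel ξ (psym n) / ((n : ℕ) : ℝ))) • heis q t ((n : ℕ) : ℤ) w) =
      fun w : SymFun => ξ • MvPolynomial.pderiv (1 : ℕ+) w := by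
    funext w
    rw [finsum_eq_single _ 1 fun n hn => by simp [plancherel, psym, hn]]
    have h1 : heis q t (((1 : ℕ+) : ℕ) : ℤ) w =
        ((1 - q) / (1 - t)) • MvPolynomial.pderiv (1 : ℕ+) w := by
      change (((0 + 1 : ℕ) : ℝ) * ((1 - q ^ (0 + 1)) / (1 - t ^ (0 + 1)))) •
        MvPolynomial.pderiv (1 : ℕ+) w = _
      simp
    have hq1 : 1 - q ≠ 0 := by linarith [hq.2]
    have ht1 : 1 - t ≠ 0 := by linarith [ht.2]
    rw [h1, smul_smul]
    congr 1
    simp only [plancherel, psym, MvPolynomial.aeval_X, if_true, PNat.one_coe, pow_one,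
      Nat.cast_one, div_one]
    field_simp
  rw [h]

lemma braGammaMinus_plancherel {q t : ℝ} (hq : q ∈ Set.Ioo (0 : ℝ) 1)
    (ht : t ∈ Set.Ioo (0 : ℝ) 1) (ξ : ℝ) (v : SymFun) :
    braGammaMinus q t (plancherel ξ) v = shift ξ v := by
  rw [← gammaPlusKet_plancherel hq ht]
  simp only [braGammaMinus, gammaPlusKet, heisRight, neg_neg]

/-! ### The semigroup property -/

/-- The matrix elements `⟨F| Γ(ρ_a)_- u^D Γ(ρ_a)_+ |G⟩`. -/
def kern (q t a u : ℝ) : SymFun →ₗ[ℝ] SymFun →ₗ[ℝ] ℝ :=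
  (form q t).compl₁₂ (shift a).toLinearMap ((degreeOp u).toLinearMap ∘ₗ (shift a).toLinearMap)

lemma kern_apply (q t a u : ℝ) (F G : SymFun) :
    kern q t a u F G = form q t (shift a F) (degreeOp u (shift a G)) := rfl

lemma kern_comm (q t a u : ℝ) (F G : SymFun) : kern q t a u F G = kern q t a u G F := by
  rw [kern_apply, kern_apply, form_comm, form_degreeOp]

lemma pderiv_shift (a : ℝ) (r : ℕ+) (F : SymFun) :
    MvPolynomial.pderiv r (shift a F) = shift a (MvPolynomial.pderiv r F) := by
  induction F using MvPolynomial.induction_on with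
  | C c => simp [MvPolynomial.algHom_C, MvPolynomial.algebraMap_eq]
  | add f g hf hg => simp only [map_add, hf, hg]
  | mul_X f s hf =>
    have h : MvPolynomial.pderiv r (shift a (MvPolynomial.X s)) =
        shift a (MvPolynomial.pderiv r (MvPolynomial.X s)) := by
      rw [shift_X, map_add, MvPolynomial.pderiv_C, add_zero, MvPolynomial.pderiv_X,
        Pi.single_apply]
      split_ifs <;> simp
    simp only [map_mul, map_add, Derivation.leibniz, smul_eq_mul, hf, h]

lemma pderiv_degreeOp (u : ℝ) (r : ℕ+) (F : SymFun) :
    MvPolynomial.pderiv r (degreeOp u F) =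
      u ^ (r : ℕ) • degreeOp u (MvPolynomial.pderiv r F) := by
  induction F using MvPolynomial.induction_on with
  | C c => simp [MvPolynomial.algHom_C, MvPolynomial.algebraMap_eq]
  | add f g hf hg => simp only [map_add, hf, hg, smul_add]
  | mul_X f s hf =>
    have h : MvPolynomial.pderiv r (degreeOp u (MvPolynomial.X s)) =
        u ^ (r : ℕ) • degreeOp u (MvPolynomial.pderiv r (MvPolynomial.X s)) := by
      rw [degreeOp, MvPolynomial.aeval_X, Derivation.map_smul, psym, MvPolynomial.pderiv_X,
        Pi.single_apply]
      split_ifs with hs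
      · subst hs; simp
      · simp
    simp only [map_mul, map_add, Derivation.leibniz, smul_eq_mul, hf, h, smul_add,
      mul_smul_comm]

/-- Commuting the creation operator `a_{-r}` through `Γ_- u^D Γ_+`. -/
lemma kern_X_mul (q t a u : ℝ) (r : ℕ+) (F G : SymFun) :
    kern q t a u (MvPolynomial.X r * F) G = (if r = 1 then a else 0) * kern q t a u F G +
      u ^ (r : ℕ) * (charge q t r * kern q t a u F (MvPolynomial.pderiv r G)) := by
  rw [kern_apply, map_mul, shift_X, add_mul, map_add, LinearMap.add_apply,
    ← MvPolynomial.smul_eq_C_mul, map_smul, LinearMap.smul_apply, smul_eq_mul, form_X_mul,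
    pderiv_degreeOp, pderiv_shift, map_smul, smul_eq_mul, kern_apply, kern_apply]
  ring

lemma kern_one_right (q t a u : ℝ) (F : SymFun) : kern q t a u F 1 = plancherel a F := by
  induction F using MvPolynomial.induction_on with
  | C c =>
    have h1 : form q t 1 1 = 1 := by
      have h := form_pMon_pMon q t 0 0
      rw [if_pos rfl] at h
      rwa [zWeight_eq, Finsupp.prod_zero_index] at h
    rw [← mul_one (MvPolynomial.C c), ← MvPolynomial.smul_eq_C_mul, LinearMap.map_smul₂,
      kern_apply, map_one (shift a), map_one (degreeOp u), h1, map_smul, map_one]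
  | add f g hf hg => rw [map_add, LinearMap.add_apply, hf, hg, map_add]
  | mul_X f r hf =>
    rw [mul_comm, kern_X_mul, hf, MvPolynomial.pderiv_one, map_zero, mul_zero, mul_zero, add_zero,
      map_mul]
    simp [plancherel]

lemma hasSum_of_eq {ι : Type*} {f g : ι → ℝ} {a b : ℝ} (h : HasSum f a) (hfg : ∀ i, g i = f i)
    (hab : b = a) : HasSum g b := by
  rw [hab, funext hfg]; exact h

/-- Summation by parts: in the resolution of the identity `∑ p_d ⊗ p_d / z_d`, the operator
`r (1 - q^r) / (1 - t^r) ∂/∂p_r` on one side is multiplication by `p_r` on the other. -/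
lemma hasSum_charge_mul_pderiv {q t : ℝ} (hq : q ∈ Set.Ioo (0 : ℝ) 1)
    (ht : t ∈ Set.Ioo (0 : ℝ) 1) (f g : SymFun →ₗ[ℝ] ℝ) (r : ℕ+) {S : ℝ}
    (h : HasSum (fun d => (zWeight q t d)⁻¹ * (f (pMon d) * g (MvPolynomial.X r * pMon d))) S) :
    HasSum (fun d => (zWeight q t d)⁻¹ *
      (charge q t r * f (MvPolynomial.pderiv r (pMon d)) * g (pMon d))) S := by
  have hinj : Function.Injective fun d : ℕ+ →₀ ℕ => d + Finsupp.single r 1 :=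
    add_left_injective _
  refine (hinj.hasSum_iff fun d hd => ?_).1 ?_
  · have h0 : d r = 0 := by
      by_contra h0
      refine hd ⟨d - Finsupp.single r 1, ?_⟩
      ext i
      by_cases hi : i = r
      · subst hi; simp; omega
      · simp [Ne.symm hi]
    rw [MvPolynomial.pderiv_monomial, h0]
    simp
  · refine hasSum_of_eq h (fun d => ?_) rfl
    have hX : (MvPolynomial.X r : SymFun) * pMon d = pMon (d + Finsupp.single r 1) := by
      rw [mul_comm, MvPolynomial.X, MvPolynomial.monomial_mul, mul_one]
    have hD : MvPolynomial.pderiv r (pMon (d + Finsupp.single r 1)) =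
        ((d r + 1 : ℕ) : ℝ) • pMon d := by
      rw [MvPolynomial.pderiv_monomial, MvPolynomial.smul_monomial]
      simp
    have hk := (charge_pos hq ht r).ne'
    have hz := (zWeight_pos hq ht d).ne'
    have hn : ((d r + 1 : ℕ) : ℝ) ≠ 0 := by positivity
    rw [Function.comp_apply, hX, hD, map_smul, zWeight_add_single, smul_eq_mul]
    field_simp

lemma plancherel_pMon_of_ne (a : ℝ) {d : ℕ+ →₀ ℕ} (hd : d ∉ Set.range (Finsupp.single (1 : ℕ+))) :
    plancherel a (pMon d) = 0 := by
  obtain ⟨r, hr, hr1⟩ : ∃ r, d r ≠ 0 ∧ r ≠ 1 := by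
    by_contra! h
    refine hd ⟨d 1, ?_⟩
    ext r
    by_cases hr : r = 1
    · subst hr; simp
    · rw [Finsupp.single_eq_of_ne hr]
      by_contra h0
      exact hr (h r (Ne.symm h0))
  rw [plancherel, MvPolynomial.aeval_monomial, map_one, one_mul, Finsupp.prod]
  exact Finset.prod_eq_zero (Finsupp.mem_support_iff.2 hr) (by simp [hr1, hr])

lemma hasSum_kern_one (q t : ℝ)
    (a b u v : ℝ) :
    HasSum (fun d => (zWeight q t d)⁻¹ * (kern q t a u 1 (pMon d) * kern q t b v (pMon d) 1))
      (Real.exp (a * b / charge q t 1)) := by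
  simp only [kern_comm q t a u 1, kern_one_right]
  refine ((Finsupp.single_injective (1 : ℕ+)).hasSum_iff fun d hd => ?_).1 ?_
  · rw [plancherel_pMon_of_ne a hd]; simp
  · have h := NormedSpace.expSeries_div_hasSum_exp (𝔸 := ℝ) (a * b / charge q t 1)
    rw [← Real.exp_eq_exp_ℝ] at h
    refine hasSum_of_eq h (fun n => ?_) rfl
    rw [Function.comp_apply, plancherel, plancherel, MvPolynomial.aeval_monomial,
      MvPolynomial.aeval_monomial, map_one, one_mul, one_mul, zWeight_eq,
      Finsupp.prod_single_index (by simp), Finsupp.prod_single_index (by simp),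
      Finsupp.prod_single_index (by simp)]
    simp only [if_true, div_pow, mul_pow]
    field_simp

/-- The semigroup law of the operators `Γ(ρ_a)_- u^D Γ(ρ_a)_+`, the intermediate states being
summed over the power-sum monomials. -/
lemma hasSum_kern_mul_kern {q t : ℝ} (hq : q ∈ Set.Ioo (0 : ℝ) 1) (ht : t ∈ Set.Ioo (0 : ℝ) 1)
    {a b c u v : ℝ} (h1 : c = a + u * b) (h2 : c = b + v * a) (F G : SymFun) :
    HasSum (fun d => (zWeight q t d)⁻¹ * (kern q t a u F (pMon d) * kern q t b v (pMon d) G))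
      (Real.exp (a * b / charge q t 1) * kern q t c (u * v) F G) := by
  have hC : ∀ x : ℝ, (MvPolynomial.C x : SymFun) = x • 1 := fun x => by
    rw [MvPolynomial.smul_eq_C_mul, mul_one]
  have hbase : ∀ G, HasSum (fun d => (zWeight q t d)⁻¹ *
      (kern q t a u 1 (pMon d) * kern q t b v (pMon d) G))
      (Real.exp (a * b / charge q t 1) * kern q t c (u * v) 1 G) := by
    intro G
    induction G using MvPolynomial.induction_on with
    | C x =>
      refine hasSum_of_eq ((hasSum_kern_one q t a b u v).mul_left x) (fun d => ?_) ?_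
      · rw [hC, map_smul, smul_eq_mul]; ring
      · rw [hC, map_smul, kern_one_right, map_one, smul_eq_mul]; ring
    | add f g hf hg =>
      refine hasSum_of_eq (hf.add hg) (fun d => ?_) ?_
      · rw [map_add]; ring
      · rw [map_add, mul_add]
    | mul_X f r hf =>
      have hs := hasSum_charge_mul_pderiv hq ht ((kern q t b v).flip f) (kern q t a u 1) r
        (hasSum_of_eq (hf.mul_left (if r = 1 then a else 0)) (fun d => by
          rw [LinearMap.flip_apply, kern_comm q t a u 1, kern_X_mul, MvPolynomial.pderiv_one,
            map_zero, kern_comm q t a u (pMon d) 1]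
          ring) rfl)
      refine hasSum_of_eq ((hf.mul_left (if r = 1 then b else 0)).add
        (hs.mul_left (v ^ (r : ℕ)))) (fun d => ?_) ?_
      · rw [kern_comm q t b v, mul_comm f, kern_X_mul, kern_comm q t b v f,
          kern_comm q t b v f, LinearMap.flip_apply]
        ring
      · rw [kern_comm q t c, mul_comm f, kern_X_mul, MvPolynomial.pderiv_one, map_zero,
          kern_comm q t c]
        split_ifs with hr
        · subst hr
          rw [mul_zero, mul_zero, add_zero, PNat.one_coe, pow_one]
          linear_combination
            Real.exp (a * b / charge q t 1) * kern q t c (u * v) 1 f * h2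
        · ring
  induction F using MvPolynomial.induction_on generalizing G with
  | C x =>
    refine hasSum_of_eq ((hbase G).mul_left x) (fun d => ?_) ?_
    · rw [hC, LinearMap.map_smul₂, smul_eq_mul]; ring
    · rw [hC, LinearMap.map_smul₂, smul_eq_mul]; ring
  | add f g hf hg =>
    refine hasSum_of_eq ((hf G).add (hg G)) (fun d => ?_) ?_
    · rw [LinearMap.map_add₂]; ring
    · rw [LinearMap.map_add₂]; ring
  | mul_X f r hf =>
    have hs := hasSum_charge_mul_pderiv hq ht (kern q t a u f) ((kern q t b v).flip G) r
      (hasSum_of_eq (((hf G).mul_left (if r = 1 then b else 0)).add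
        (((hf (MvPolynomial.pderiv r G)).mul_left (charge q t r)).mul_left (v ^ (r : ℕ))))
        (fun d => by rw [LinearMap.flip_apply, kern_X_mul]; ring) rfl)
    refine hasSum_of_eq (((hf G).mul_left (if r = 1 then a else 0)).add
      (hs.mul_left (u ^ (r : ℕ)))) (fun d => ?_) ?_
    · rw [mul_comm f, kern_X_mul, LinearMap.flip_apply]
      ring
    · rw [mul_comm f, kern_X_mul]
      split_ifs with hr
      · subst hr
        rw [PNat.one_coe, pow_one, pow_one, pow_one]
        linear_combination
          Real.exp (a * b / charge q t 1) * kern q t c (u * v) f G * h1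
      · ring

lemma transfer_eq {q t : ℝ} (hq : q ∈ Set.Ioo (0 : ℝ) 1) (ht : t ∈ Set.Ioo (0 : ℝ) 1)
    (γ u : ℝ) (lam mu : YSet) :
    transfer q t γ u lam mu = Real.exp ((1 - t) / (1 - q) * γ ^ 2 * (u - 1)) *
      kern q t (γ * (1 - u)) u (macP q t lam) (macQ q t mu) := by
  rw [transfer, gammaPlusKet_plancherel hq ht, braGammaMinus_plancherel hq ht]
  rfl

lemma macQ_eq_dual (q t : ℝ) : macQ q t = dual q t (macP q t) := rfl

lemma hasSum_transfer_mul_transfer {q t : ℝ} (hq : q ∈ Set.Ioo (0 : ℝ) 1)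
    (ht : t ∈ Set.Ioo (0 : ℝ) 1) (hP : IsHomOrth q t (macP q t)) (γ u v : ℝ) (lam nu : YSet) :
    HasSum (fun mu : YSet => transfer q t γ u lam mu * transfer q t γ v mu nu)
      (transfer q t γ (u * v) lam nu) := by
  have hf := hasSum_kern_mul_kern hq ht (a := γ * (1 - v)) (b := γ * (1 - v)) (u := v) (v := v)
    rfl rfl (macQ q t nu) (macQ q t nu)
  have hg := hasSum_kern_mul_kern hq ht (a := γ * (1 - u)) (b := γ * (1 - u)) (u := u) (v := u)
    rfl rfl (macP q t lam) (macP q t lam)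
  have hfg := hasSum_kern_mul_kern hq ht (a := γ * (1 - u)) (b := γ * (1 - v))
    (c := γ * (1 - u * v)) (u := u) (v := v) (by ring) (by ring) (macP q t lam) (macQ q t nu)
  have h := hP.hasSum_dual hq ht ((kern q t (γ * (1 - v)) v).flip (macQ q t nu))
    (kern q t (γ * (1 - u)) u (macP q t lam))
    (by simpa only [kern_comm q t _ _ (macQ q t nu), LinearMap.flip_apply] using hf.summable)
    (by simpa only [kern_comm q t _ _ _ (macP q t lam)] using hg.summable)
    (by simpa only [mul_comm, LinearMap.flip_apply] using hfg)
  have hq1 : 1 - q ≠ 0 := by linarith [hq.2]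
  have ht1 : 1 - t ≠ 0 := by linarith [ht.2]
  refine hasSum_of_eq (h.mul_left (Real.exp ((1 - t) / (1 - q) * γ ^ 2 * (u - 1)) *
    Real.exp ((1 - t) / (1 - q) * γ ^ 2 * (v - 1)))) (fun mu => ?_) ?_
  · rw [transfer_eq hq ht, transfer_eq hq ht, LinearMap.flip_apply, macQ_eq_dual]; ring
  · rw [transfer_eq hq ht, ← mul_assoc, ← Real.exp_add, ← Real.exp_add]
    congr 2
    simp only [charge, PNat.one_coe, Nat.cast_one, one_mul, pow_one]
    field_simp
    ring

/-! ### Hilbert–Schmidt bounds -/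

lemma sum_pow_wt_le_prod {s : ℝ} (h0 : 0 < s) (T : Finset (ℕ+ →₀ ℕ)) (V : Finset ℕ+) (K : ℕ)
    (hsupp : ∀ d ∈ T, d.support ⊆ V) (hK : ∀ d ∈ T, ∀ r ∈ V, d r ≤ K) :
    ∑ d ∈ T, s ^ wt d ≤ ∏ r ∈ V, ∑ k ∈ Finset.range (K + 1), (s ^ (r : ℕ)) ^ k := by
  classical
  let φ : (ℕ+ →₀ ℕ) → (∀ r ∈ V, ℕ) := fun d r _ => d r
  have hφ : Set.InjOn φ T := by
    intro d hd e he hde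
    ext r
    by_cases hr : r ∈ V
    · exact congrFun (congrFun hde r) hr
    · rw [Finsupp.notMem_support_iff.1 fun h => hr (hsupp d hd h),
        Finsupp.notMem_support_iff.1 fun h => hr (hsupp e he h)]
  have hsum : ∀ d ∈ T, s ^ wt d = ∏ x ∈ V.attach, (s ^ (x.1 : ℕ)) ^ φ d x.1 x.2 := by
    intro d hd
    rw [Finset.prod_attach V fun r => (s ^ (r : ℕ)) ^ d r, Finsupp.weight_apply,
      Finsupp.sum_of_support_subset d (hsupp d hd) _ (by simp), ← Finset.prod_pow_eq_pow_sum]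
    exact Finset.prod_congr rfl fun r _ => by rw [← pow_mul, smul_eq_mul, mul_comm]
  have himage : T.image φ ⊆ V.pi fun _ => Finset.range (K + 1) := by
    intro p hp
    obtain ⟨d, hd, rfl⟩ := Finset.mem_image.1 hp
    exact Finset.mem_pi.2 fun r hr => Finset.mem_range.2 (Nat.lt_succ_of_le (hK d hd r hr))
  rw [Finset.prod_sum V (fun _ => Finset.range (K + 1)) fun r k => (s ^ (r : ℕ)) ^ k,
    Finset.sum_congr rfl hsum,
    ← Finset.sum_image (f := fun p : ∀ r ∈ V, ℕ =>
      ∏ x ∈ V.attach, (s ^ (x.1 : ℕ)) ^ p x.1 x.2) hφ]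
  exact Finset.sum_le_sum_of_subset_of_nonneg himage fun p _ _ =>
    Finset.prod_nonneg fun _ _ => by positivity

lemma prod_sum_pow_le_exp {s : ℝ} (h0 : 0 < s) (h1 : s < 1) (V : Finset ℕ+) (K : ℕ) :
    ∏ r ∈ V, ∑ k ∈ Finset.range (K + 1), (s ^ (r : ℕ)) ^ k ≤
      Real.exp (∑ r ∈ V, s ^ (r : ℕ) / (1 - s)) := by
  rw [Real.exp_sum]
  refine Finset.prod_le_prod (fun r _ => Finset.sum_nonneg fun _ _ => by positivity)
    fun r _ => ?_
  have hr0 : 0 < s ^ (r : ℕ) := by positivity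
  have hrs : s ^ (r : ℕ) ≤ s := pow_le_of_le_one h0.le h1.le r.ne_zero
  have hr1 : s ^ (r : ℕ) < 1 := hrs.trans_lt h1
  calc ∑ k ∈ Finset.range (K + 1), (s ^ (r : ℕ)) ^ k ≤ (1 - s ^ (r : ℕ))⁻¹ := by
        rw [← tsum_geometric_of_lt_one hr0.le hr1]
        exact (summable_geometric_of_lt_one hr0.le hr1).sum_le_tsum _
          fun _ _ => by positivity
    _ = s ^ (r : ℕ) / (1 - s ^ (r : ℕ)) + 1 := by
        have : 1 - s ^ (r : ℕ) ≠ 0 := by linarith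
        field_simp; ring
    _ ≤ s ^ (r : ℕ) / (1 - s) + 1 := by
        have : 0 < 1 - s := by linarith
        gcongr
    _ ≤ _ := Real.add_one_le_exp _

/-- The generating function of partitions converges in the unit disc. -/
lemma summable_pow_wt {s : ℝ} (h0 : 0 < s) (h1 : s < 1) : Summable fun d : ℕ+ →₀ ℕ => s ^ wt d := by
  have hs : Summable fun r : ℕ+ => s ^ (r : ℕ) / (1 - s) :=
    ((summable_geometric_of_lt_one h0.le h1).comp_injective PNat.coe_injective).div_const _
  refine summable_of_sum_le (c := Real.exp (∑' r : ℕ+, s ^ (r : ℕ) / (1 - s)))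
    (fun d => by positivity) fun T => ?_
  obtain ⟨V, hsupp⟩ : ∃ V : Finset ℕ+, ∀ d ∈ T, d.support ⊆ V :=
    ⟨T.biUnion Finsupp.support, fun d hd => Finset.subset_biUnion_of_mem _ hd⟩
  obtain ⟨K, hK⟩ : ∃ K : ℕ, ∀ d ∈ T, ∀ r ∈ V, d r ≤ K :=
    ⟨∑ d ∈ T, ∑ r ∈ V, d r, fun d hd r hr =>
      (Finset.single_le_sum (fun _ _ => Nat.zero_le _) hr).trans
        (Finset.single_le_sum (f := fun d : ℕ+ →₀ ℕ => ∑ r ∈ V, d r)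
          (fun _ _ => Nat.zero_le _) hd)⟩
  exact (sum_pow_wt_le_prod h0 T V K hsupp hK).trans ((prod_sum_pow_le_exp h0 h1 V K).trans
    (Real.exp_le_exp.2 (hs.sum_le_tsum V fun r _ => div_nonneg (by positivity) (by linarith))))

lemma kern_self_nonneg {q t : ℝ} (hq : q ∈ Set.Ioo (0 : ℝ) 1) (ht : t ∈ Set.Ioo (0 : ℝ) 1)
    (ξ : ℝ) {w : ℝ} (hw : 0 < w) (f : SymFun) : 0 ≤ kern q t ξ w f f := by
  rw [kern_apply, ← pairing_eq_form, pairing]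
  refine Finset.sum_nonneg fun d _ => ?_
  rw [coeff_degreeOp, mul_left_comm]
  have := zWeight_pos hq ht d
  have := mul_self_nonneg ((shift ξ f).coeff d)
  positivity

lemma kern_pMon_self (q t ξ w : ℝ) (d : ℕ+ →₀ ℕ) :
    kern q t ξ w (pMon d) (pMon d) = ∑ k ∈ Finset.range (d 1 + 1),
      ((d 1).choose k * ξ ^ k) ^ 2 * w ^ (wt d - k) * zWeight q t (d - Finsupp.single 1 k) := by
  have hwt : ∀ k ∈ Finset.range (d 1 + 1), wt (d - Finsupp.single 1 k) = wt d - k := by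
    intro k hk
    have hle : Finsupp.single 1 k ≤ d := by
      rw [Finsupp.single_le_iff]; exact Nat.lt_succ_iff.1 (Finset.mem_range.1 hk)
    have h : wt (d - Finsupp.single 1 k) + wt (Finsupp.single (1 : ℕ+) k) = wt d := by
      rw [← map_add, tsub_add_cancel_of_le hle]
    rw [Finsupp.weight_single] at h
    simp at h
    omega
  rw [kern_apply, shift_pMon, map_sum, map_sum, LinearMap.sum_apply]
  refine Finset.sum_congr rfl fun k hk => ?_
  rw [map_sum, Finset.sum_eq_single k]
  · rw [map_smul (degreeOp w), degreeOp_pMon, hwt k hk]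
    simp only [map_smul, LinearMap.smul_apply, form_pMon_pMon, if_true, smul_eq_mul]
    ring
  · intro l hl hlk
    rw [map_smul (degreeOp w), degreeOp_pMon]
    simp only [map_smul, LinearMap.smul_apply, form_pMon_pMon, smul_eq_mul]
    rw [if_neg, mul_zero, mul_zero, mul_zero]
    intro h
    have := DFunLike.congr_fun h 1
    simp only [Finsupp.tsub_apply, Finsupp.single_eq_same] at this
    rw [Finset.mem_range] at hk hl
    omega
  · exact fun h => absurd hk h

lemma kern_pMon_self_le {q t : ℝ} (hq : q ∈ Set.Ioo (0 : ℝ) 1) (ht : t ∈ Set.Ioo (0 : ℝ) 1)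
    (ξ : ℝ) {s : ℝ} (h0 : 0 < s) (h1 : s < 1) (d : ℕ+ →₀ ℕ) :
    (zWeight q t d)⁻¹ * kern q t ξ (s ^ 2) (pMon d) (pMon d) ≤
      Real.exp (ξ ^ 2 / charge q t 1 / (s * (1 - s))) * s ^ wt d := by
  have hκ := charge_pos hq ht 1
  have hs' : 0 < 1 - s := by linarith
  rw [kern_pMon_self, Finset.mul_sum]
  have hle1 : d 1 ≤ wt d := by
    have h : wt (d.erase 1) + wt (Finsupp.single (1 : ℕ+) (d 1)) = wt d := by
      rw [← map_add, Finsupp.erase_add_single]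
    rw [Finsupp.weight_single] at h
    simp at h
    omega
  refine le_trans (Finset.sum_le_sum fun k hk => ?_) ((Finset.sum_mul _ _ _).symm.le.trans
    (mul_le_mul_of_nonneg_right (Real.sum_le_exp_of_nonneg (by positivity) (d 1 + 1))
      (by positivity)))
  have hk : k ≤ d 1 := Nat.lt_succ_iff.1 (Finset.mem_range.1 hk)
  obtain ⟨m, hm⟩ := Nat.exists_eq_add_of_le hk
  obtain ⟨N, hN⟩ := Nat.exists_eq_add_of_le hle1
  have hz : zWeight q t d = zWeight q t (d - Finsupp.single 1 k) *
      ((k.factorial : ℝ) * (d 1).choose k * charge q t 1 ^ k) := by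
    have he : (d - Finsupp.single 1 k).erase 1 = d.erase 1 := by
      ext i
      by_cases hi : i = 1
      · simp [hi]
      · simp [Finsupp.erase_ne hi, hi]
    rw [zWeight_split q t d 1, zWeight_split q t (d - _) 1, he, Finsupp.tsub_apply,
      Finsupp.single_eq_same, hm, Nat.add_sub_cancel_left]
    have hc : (((k + m).choose k : ℝ) * k.factorial * m.factorial) = (k + m).factorial := by
      rw [Nat.choose_symm_add]
      exact_mod_cast Nat.add_choose_mul_factorial_mul_factorial k m
    rw [← hc, pow_add]; ring
  -- a single term of the binomial expansion of `(s + (1 - s)) ^ d 1 = 1`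
  have hbin : ((d 1).choose k : ℝ) * (s ^ m * (1 - s) ^ k) ≤ 1 := by
    have h := add_pow (1 - s) s (d 1)
    rw [sub_add_cancel, one_pow] at h
    refine (le_trans (le_of_eq ?_) (Finset.single_le_sum (f := fun j =>
      (1 - s) ^ j * s ^ (d 1 - j) * ((d 1).choose j : ℝ)) (fun j _ => by positivity)
      (Finset.mem_range.2 (Nat.lt_succ_of_le hk)))).trans h.ge
    rw [show d 1 - k = m by omega]; ring
  have hz' := zWeight_pos hq ht (d - Finsupp.single 1 k)
  have hch : (0 : ℝ) < (d 1).choose k := by exact_mod_cast Nat.choose_pos hk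
  have hfac : (0 : ℝ) < k.factorial := by exact_mod_cast k.factorial_pos
  have hpow : (s ^ 2) ^ (wt d - k) ≤ s ^ m * s ^ (wt d - k) := by
    rw [← pow_mul, ← pow_add]
    exact pow_le_pow_of_le_one h0.le h1.le (by omega)
  have hsplit : s ^ wt d = s ^ (wt d - k) * s ^ k := by
    rw [← pow_add]; congr 1; omega
  calc (zWeight q t d)⁻¹ * ((((d 1).choose k : ℝ) * ξ ^ k) ^ 2 * (s ^ 2) ^ (wt d - k) *
        zWeight q t (d - Finsupp.single 1 k))
      = ((ξ ^ 2) ^ k / (charge q t 1 ^ k * k.factorial)) *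
          ((d 1).choose k * (s ^ 2) ^ (wt d - k)) := by
        rw [hz]; field_simp; ring
    _ ≤ ((ξ ^ 2) ^ k / (charge q t 1 ^ k * k.factorial)) *
          ((d 1).choose k * (s ^ m * s ^ (wt d - k))) := by gcongr
    _ = ((ξ ^ 2) ^ k / (charge q t 1 ^ k * k.factorial)) *
          (((d 1).choose k * (s ^ m * (1 - s) ^ k)) * (s ^ (wt d - k) / (1 - s) ^ k)) := by
        field_simp
    _ ≤ ((ξ ^ 2) ^ k / (charge q t 1 ^ k * k.factorial)) *
          (1 * (s ^ (wt d - k) / (1 - s) ^ k)) := by gcongr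
    _ = (ξ ^ 2 / charge q t 1 / (s * (1 - s))) ^ k / k.factorial * s ^ wt d := by
        rw [hsplit, div_pow, div_pow, mul_pow]; field_simp

section

variable {q t : ℝ} {b : YSet → SymFun}

/-- The resolution of the identity by a basis and its dual. -/
lemma IsHomOrth.hasSum_form_mul_form (hq : q ∈ Set.Ioo (0 : ℝ) 1) (ht : t ∈ Set.Ioo (0 : ℝ) 1)
    (hb : IsHomOrth q t b) (F G : SymFun) :
    HasSum (fun mu => form q t F (b mu) * form q t G (PeriodicMacdonald.dual q t b mu))
      (form q t F G) := by
  have hzero : ∀ (F : SymFun) (d), d ∉ F.support → form q t F (pMon d) = 0 := fun F d hd => by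
    rw [form_pMon, MvPolynomial.notMem_support_iff.1 hd, zero_mul]
  have hsum : ∀ F : SymFun, Summable fun d =>
      (zWeight q t d)⁻¹ * (form q t F (pMon d) * form q t F (pMon d)) := fun F =>
    summable_of_ne_finset_zero (s := F.support) fun d hd => by rw [hzero F d hd]; simp
  refine hb.hasSum_dual hq ht (form q t F) (form q t G) (hsum F) (hsum G) ?_
  have h : form q t F G = ∑ d ∈ F.support, (zWeight q t d)⁻¹ *
      (form q t F (pMon d) * form q t G (pMon d)) := by
    rw [← pairing_eq_form, pairing]
    refine Finset.sum_congr rfl fun d _ => ?_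
    have := (zWeight_pos hq ht d).ne'
    rw [form_pMon, form_pMon]
    field_simp
  rw [h]
  exact hasSum_sum_of_ne_finset_zero fun d hd => by rw [hzero F d hd]; simp

/-- Squared matrix elements, in the normalized basis, of the operator `w^(D/2) Γ(ρ_ξ)_+`. -/
def sqElem (q t : ℝ) (b : YSet → SymFun) (ξ w : ℝ) (lam mu : YSet) : ℝ :=
  w ^ mu.1 * (form q t (shift ξ (dual q t b lam)) (b mu) *
    form q t (shift ξ (b lam)) (dual q t b mu))

lemma IsHomOrth.sqElem_nonneg (hq : q ∈ Set.Ioo (0 : ℝ) 1) (ht : t ∈ Set.Ioo (0 : ℝ) 1)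
    (hb : IsHomOrth q t b) (ξ : ℝ) {w : ℝ} (hw : 0 < w) (lam mu : YSet) :
    0 ≤ sqElem q t b ξ w lam mu := by
  simp only [sqElem, PeriodicMacdonald.dual, map_smul, LinearMap.smul_apply, smul_eq_mul]
  have h1 := hb.norm_pos hq ht lam
  have h2 := hb.norm_pos hq ht mu
  have h3 := mul_self_nonneg (form q t (shift ξ (b lam)) (b mu))
  rw [mul_mul_mul_comm]
  positivity

lemma IsHomOrth.hasSum_skew (hq : q ∈ Set.Ioo (0 : ℝ) 1) (ht : t ∈ Set.Ioo (0 : ℝ) 1)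
    (hb : IsHomOrth q t b) (ξ w : ℝ) (F G : SymFun) :
    HasSum (fun mu => w ^ mu.1 * (form q t (shift ξ F) (b mu) *
      form q t (shift ξ G) (PeriodicMacdonald.dual q t b mu))) (kern q t ξ w F G) := by
  refine hasSum_of_eq (hb.hasSum_form_mul_form hq ht (shift ξ F) (degreeOp w (shift ξ G)))
    (fun mu => ?_) rfl
  rw [form_degreeOp, (hb.dual hq ht).degreeOp_apply, map_smul, smul_eq_mul]
  ring

/-- The operator `w^(D/2) Γ(ρ_ξ)_+` is Hilbert–Schmidt. -/
lemma IsHomOrth.summable_sqElem (hq : q ∈ Set.Ioo (0 : ℝ) 1) (ht : t ∈ Set.Ioo (0 : ℝ) 1)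
    (hb : IsHomOrth q t b) (ξ : ℝ) {w : ℝ} (hw0 : 0 < w) (hw1 : w < 1) :
    Summable fun x : YSet × YSet => sqElem q t b ξ w x.1 x.2 := by
  have hinner : ∀ lam, HasSum (fun mu => sqElem q t b ξ w lam mu)
      (kern q t ξ w (b lam) (PeriodicMacdonald.dual q t b lam)) := fun lam => by
    rw [kern_comm]
    exact hb.hasSum_skew hq ht ξ w _ _
  refine (summable_prod_of_nonneg fun x => hb.sqElem_nonneg hq ht ξ hw0 x.1 x.2).2
    ⟨fun lam => (hinner lam).summable, ?_⟩
  simp only [fun lam => (hinner lam).tsum_eq]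
  refine hb.summable_dual hq ht (kern q t ξ w) (kern_self_nonneg hq ht ξ hw0) ?_
  have hs0 : 0 < √w := Real.sqrt_pos.2 hw0
  have hs1 : √w < 1 := (Real.sqrt_lt' one_pos).2 (by simpa using hw1)
  refine Summable.of_nonneg_of_le (fun d => ?_) (fun d => ?_)
    ((summable_pow_wt hs0 hs1).mul_left (Real.exp (ξ ^ 2 / charge q t 1 / (√w * (1 - √w)))))
  · exact mul_nonneg (inv_nonneg.2 (zWeight_pos hq ht d).le) (kern_self_nonneg hq ht ξ hw0 _)
  · have := kern_pMon_self_le hq ht ξ hs0 hs1 d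
    rwa [Real.sq_sqrt hw0.le] at this

end

/-! ### Summation over tuples -/

lemma hasSum_mul_prod {Y Z : Type*} {f : Y → ℝ} {g : Z → ℝ} {a b : ℝ} (hf : HasSum f a)
    (hg : HasSum g b) : HasSum (fun x : Y × Z => f x.1 * g x.2) (a * b) :=
  hf.mul hg (summable_mul_of_summable_norm hf.summable.norm hg.summable.norm)

lemma hasSum_fin_prod {Y : Type*} {n : ℕ} (f : Fin n → Y → ℝ) (S : Fin n → ℝ)
    (h : ∀ i, HasSum (f i) (S i)) :
    HasSum (fun x : Fin n → Y => ∏ i, f i (x i)) (∏ i, S i) := by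
  induction n with
  | zero => simp [hasSum_unique]
  | succ n ih =>
    have h1 : HasSum (fun x : Fin n → Y => ∏ i, f i.succ (x i)) (∏ i : Fin n, S i.succ) :=
      ih (fun i => f i.succ) (fun i => S i.succ) fun i => h i.succ
    have h2 := hasSum_mul_prod (h 0) h1
    rw [Fin.prod_univ_succ, ← (Fin.consEquiv fun _ => Y).hasSum_iff]
    refine hasSum_of_eq h2 (fun x => ?_) rfl
    simp [Fin.prod_univ_succ, Fin.consEquiv]

lemma summable_fin_prod_prod {Y : Type*} {n : ℕ} (f : Fin n → Y × Y → ℝ)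
    (h : ∀ i, Summable (f i)) :
    Summable fun x : (Fin n → Y) × (Fin n → Y) => ∏ i, f i (x.1 i, x.2 i) := by
  rw [← (Equiv.arrowProdEquivProdArrow (Fin n) (fun _ => Y) (fun _ => Y)).summable_iff]
  exact (hasSum_fin_prod f _ fun i => (h i).hasSum).summable

/-! ### Specialized skew functions -/

/-- Specializing the first alphabet of `F(X, Y)` at `ρ_ξ` shifts `p_1` by `ξ`. -/
lemma plancherel_skew {q t : ℝ} {b : YSet → SymFun} (hq : q ∈ Set.Ioo (0 : ℝ) 1)
    (ht : t ∈ Set.Ioo (0 : ℝ) 1) (hb : IsHomOrth q t b) (ξ : ℝ) (lam mu : YSet) :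
    plancherel ξ (skew b lam mu) = form q t (shift ξ (b lam)) (dual q t b mu) := by
  let Λ : SymFun ⊗[ℝ] SymFun →ₐ[ℝ] SymFun := Algebra.TensorProduct.lift
    ((Algebra.ofId ℝ SymFun).comp (plancherel ξ)) (AlgHom.id ℝ SymFun) fun _ _ => Commute.all _ _
  have hΛ : Λ.comp twoAlphabets = shift ξ := by
    refine MvPolynomial.algHom_ext fun r => ?_
    rw [AlgHom.comp_apply, twoAlphabets, MvPolynomial.aeval_X, shift_X, map_add,
      Algebra.TensorProduct.lift_tmul, Algebra.TensorProduct.lift_tmul]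
    simp only [map_one, one_mul, mul_one, AlgHom.id_apply, AlgHom.comp_apply, psym, plancherel,
      MvPolynomial.aeval_X]
    exact add_comm _ _
  have hφ : ∀ (φ : SymFun →ₗ[ℝ] ℝ) (x : SymFun ⊗[ℝ] SymFun),
      plancherel ξ (TensorProduct.rid ℝ SymFun (φ.lTensor SymFun x)) = φ (Λ x) := by
    intro φ x
    induction x using TensorProduct.induction_on with
    | zero => simp
    | tmul f g =>
      rw [LinearMap.lTensor_tmul, TensorProduct.rid_tmul, map_smul,
        Algebra.TensorProduct.lift_tmul, AlgHom.comp_apply, Algebra.ofId_apply, AlgHom.id_apply,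
        ← Algebra.smul_def, map_smul, smul_eq_mul, smul_eq_mul, mul_comm]
    | add x y hx hy => simp only [map_add, hx, hy]
  rw [skew, hφ, hb.expansionCoeff_eq hq ht, form_comm, ← hΛ]
  rfl

lemma pow_mul_form_shift {q t : ℝ} {b c : YSet → SymFun} (hb : IsHomOrth q t b)
    (hc : IsHomOrth q t c) (x ξ : ℝ) (lam mu : YSet) :
    x ^ mu.1 * form q t (shift (x * ξ) (b lam)) (c mu) =
      x ^ lam.1 * form q t (shift ξ (b lam)) (c mu) := by
  rw [← smul_eq_mul, ← map_smul, ← hc.degreeOp_apply, ← form_degreeOp, degreeOp_shift,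
    hb.degreeOp_apply, map_smul, map_smul, LinearMap.smul_apply, smul_eq_mul]

/-- Cyclic products do not see factors of the form `f (i + 1) / f i`. -/
lemma prod_eq_of_cocycle {n : ℕ} (x y f : Fin (n + 1) → ℝ) (hf : ∀ i, f i ≠ 0)
    (h : ∀ i, x i = y i * (f (i + 1) * (f i)⁻¹)) : ∏ i, x i = ∏ i, y i := by
  have hshift : ∏ i, f (i + 1) = ∏ i, f i := Equiv.prod_comp (Equiv.addRight (1 : Fin (n + 1))) f
  rw [Finset.prod_congr rfl fun i _ => h i, Finset.prod_mul_distrib, Finset.prod_mul_distrib,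
    hshift, ← Finset.prod_mul_distrib, Finset.prod_eq_one fun i _ => mul_inv_cancel₀ (hf i),
    mul_one]

/-! ### The weights of the periodic process -/

section

variable {q t γ β : ℝ} {n : ℕ} {b : ℕ → ℝ}

/-- The weights as cyclic products of matrix elements of `w^D` and of the vertex operators
`Γ(ρ_ξ)_±`, where `w = e^{-(b_{i+1} - b_i)}` and `ξ = γ (1 - w)`: conjugation by
`(e^{-b_i})^D` turns the specializations `ρ^±` into these, and the conjugating factors cancel
around the cycle, since `b_0 = 0`. -/
lemma periodicWeight_eq (hq : q ∈ Set.Ioo (0 : ℝ) 1) (ht : t ∈ Set.Ioo (0 : ℝ) 1)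
    (hb : IsTimeSequence β n b) (w : Fin (n + 1) → ℝ)
    (hw : ∀ i, w i = Real.exp (-(b ((i : ℕ) + 1) - b (i : ℕ)))) (lam mu : Fin (n + 1) → YSet) :
    periodicWeight q t (Real.exp (-β)) (rhoPlus γ β n b) (rhoMinus γ n b) lam mu =
      ∏ i, w i ^ (mu i).1 *
        (form q t (shift (γ * (1 - w i)) (macQ q t (lam i))) (macP q t (mu i)) *
          form q t (shift (γ * (1 - w i)) (macP q t (lam (i + 1)))) (macQ q t (mu i))) := by
  have hP := isHomOrth_macP q t
  have hQ : IsHomOrth q t (macQ q t) := hP.dual hq ht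
  have hlast : Real.exp (-β) ^ (mu (Fin.last n)).1 =
      ∏ i, if i = Fin.last n then Real.exp (-β) ^ (mu i).1 else 1 := by
    rw [Finset.prod_ite_eq' Finset.univ (Fin.last n) fun i => Real.exp (-β) ^ (mu i).1]
    simp
  have hminus : ∀ i : Fin (n + 1), rhoMinus γ n b i (skewQ q t (lam i) (mu i)) =
      (Real.exp (-b (i : ℕ)) ^ (mu i).1)⁻¹ * (Real.exp (-b (i : ℕ)) ^ (lam i).1 *
        form q t (shift (γ * (1 - w i)) (macQ q t (lam i))) (macP q t (mu i))) := by
    intro i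
    have hx : γ * (Real.exp (-b (i : ℕ)) - Real.exp (-b ((i : ℕ) + 1))) =
        Real.exp (-b (i : ℕ)) * (γ * (1 - w i)) := by
      have : Real.exp (-b ((i : ℕ) + 1)) = Real.exp (-b (i : ℕ)) * w i := by
        rw [hw, ← Real.exp_add]; congr 1; ring
      rw [this]; ring
    have hd : dual q t (macQ q t) = macP q t := hP.dual_dual hq ht
    rw [rhoMinus, skewQ, plancherel_skew hq ht hQ, hd, hx, ← pow_mul_form_shift hQ hP,
      inv_mul_cancel_left₀ (by positivity)]
  have hplus : ∀ i : Fin (n + 1), (if i = Fin.last n then Real.exp (-β) ^ (mu i).1 else 1) *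
      rhoPlus γ β n b (i + 1) (skewP q t (lam (i + 1)) (mu i)) =
      Real.exp (-b ((i : ℕ) + 1)) ^ (mu i).1 *
        (Real.exp (b ((i + 1 : Fin (n + 1)) : ℕ)) ^ (lam (i + 1)).1 *
          form q t (shift (γ * (1 - w i)) (macP q t (lam (i + 1)))) (macQ q t (mu i))) := by
    intro i
    by_cases hi : i = Fin.last n
    · subst hi
      have h0 : Fin.last n + 1 = 0 := by simp
      have hwl : w (Fin.last n) = Real.exp (b n - β) := by
        rw [hw, Fin.val_last, hb.last]; congr 1; ring
      rw [if_pos rfl, h0, rhoPlus, if_pos rfl, skewP, plancherel_skew hq ht hP, hwl,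
        Fin.val_last, hb.last, Fin.val_zero, hb.zero, Real.exp_zero, one_pow, one_mul]
      rfl
    · have hval : ((i + 1 : Fin (n + 1)) : ℕ) = (i : ℕ) + 1 := by
        rw [Fin.val_add_one_of_lt (Fin.lt_last_iff_ne_last.2 hi)]
      have hne : i + 1 ≠ 0 := fun h => by
        have := congrArg Fin.val h
        rw [hval] at this
        simp at this
      have hx : γ * (Real.exp (b ((i : ℕ) + 1)) - Real.exp (b (i : ℕ))) =
          Real.exp (b ((i : ℕ) + 1)) * (γ * (1 - w i)) := by
        have : Real.exp (b (i : ℕ)) = Real.exp (b ((i : ℕ) + 1)) * w i := by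
          rw [hw, ← Real.exp_add]; congr 1; ring
        rw [this]; ring
      rw [if_neg hi, one_mul, rhoPlus, if_neg hne, hval, Nat.add_sub_cancel, hx, skewP,
        plancherel_skew hq ht hP, ← macQ_eq_dual, ← pow_mul_form_shift hP hQ, Real.exp_neg,
        inv_pow, inv_mul_cancel_left₀ (by positivity)]
  rw [periodicWeight, hlast, ← Finset.prod_mul_distrib]
  -- the conjugations leave over `e^{b_{i+1} |lam_{i+1}|} / e^{b_i |lam_i|}`
  refine prod_eq_of_cocycle _ _ (fun i => Real.exp (b (i : ℕ)) ^ (lam i).1)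
    (fun i => by positivity) fun i => ?_
  have hwi : w i ^ (mu i).1 =
      (Real.exp (-b (i : ℕ)) ^ (mu i).1)⁻¹ * Real.exp (-b ((i : ℕ) + 1)) ^ (mu i).1 := by
    rw [← inv_pow, ← mul_pow, ← Real.exp_neg, ← Real.exp_add, hw]
    congr 2; ring
  have hinv : Real.exp (-b (i : ℕ)) ^ (lam i).1 = (Real.exp (b (i : ℕ)) ^ (lam i).1)⁻¹ := by
    rw [Real.exp_neg, inv_pow]
  rw [mul_left_comm, hplus, hminus, hwi, hinv]
  ring

lemma summable_fin_prod_prod_shift {Y : Type*} (f : Fin (n + 1) → Y × Y → ℝ)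
    (h : ∀ i, Summable (f i)) :
    Summable fun x : (Fin (n + 1) → Y) × (Fin (n + 1) → Y) => ∏ i, f i (x.1 (i + 1), x.2 i) := by
  let e : (Fin (n + 1) → Y) ≃ (Fin (n + 1) → Y) :=
    (Equiv.addRight (1 : Fin (n + 1))).symm.arrowCongr (Equiv.refl Y)
  exact (Equiv.summable_iff (f := fun x : (Fin (n + 1) → Y) × (Fin (n + 1) → Y) =>
    ∏ i, f i (x.1 i, x.2 i)) (e.prodCongr (Equiv.refl _))).2 (summable_fin_prod_prod f h)

/-- The weights are absolutely summable: by Cauchy–Schwarz around the cycle, they are dominated by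
products of squared matrix elements of Hilbert–Schmidt operators. -/
lemma summable_periodicWeight (hq : q ∈ Set.Ioo (0 : ℝ) 1) (ht : t ∈ Set.Ioo (0 : ℝ) 1)
    (hb : IsTimeSequence β n b) :
    Summable fun x : (Fin (n + 1) → YSet) × (Fin (n + 1) → YSet) =>
      periodicWeight q t (Real.exp (-β)) (rhoPlus γ β n b) (rhoMinus γ n b) x.1 x.2 := by
  have hP := isHomOrth_macP q t
  let w : Fin (n + 1) → ℝ := fun i => Real.exp (-(b ((i : ℕ) + 1) - b (i : ℕ)))
  have hw0 : ∀ i, 0 < w i := fun i => Real.exp_pos _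
  have hw1 : ∀ i, w i < 1 := fun i => by
    have := hb.lt i (Nat.lt_succ_iff.1 i.2)
    exact Real.exp_lt_one_iff.2 (by linarith)
  let f : Fin (n + 1) → YSet × YSet → ℝ := fun i x =>
    sqElem q t (macP q t) (γ * (1 - w i)) (w i) x.1 x.2
  have hf0 : ∀ i x, 0 ≤ f i x := fun i x => hP.sqElem_nonneg hq ht _ (hw0 i) _ _
  have hf : ∀ i, Summable (f i) := fun i => hP.summable_sqElem hq ht _ (hw0 i) (hw1 i)
  refine Summable.of_norm_bounded ((summable_fin_prod_prod f hf).add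
    (summable_fin_prod_prod_shift f hf)) fun x => ?_
  obtain ⟨lam, mu⟩ := x
  have hA : 0 ≤ ∏ i, f i (lam i, mu i) := Finset.prod_nonneg fun i _ => hf0 i _
  have hB : 0 ≤ ∏ i, f i (lam (i + 1), mu i) := Finset.prod_nonneg fun i _ => hf0 i _
  have hN : ∀ nu, form q t (macP q t nu) (macP q t nu) ≠ 0 := fun nu =>
    (hP.norm_pos hq ht nu).ne'
  have hsq : periodicWeight q t (Real.exp (-β)) (rhoPlus γ β n b) (rhoMinus γ n b) lam mu ^ 2 =
      (∏ i, f i (lam i, mu i)) * ∏ i, f i (lam (i + 1), mu i) := by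
    rw [periodicWeight_eq hq ht hb w fun _ => rfl, ← Finset.prod_pow, ← Finset.prod_mul_distrib]
    refine prod_eq_of_cocycle _ _ (fun i => form q t (macP q t (lam i)) (macP q t (lam i)))
      (fun i => hN _) fun i => ?_
    have h1 := hN (lam (i + 1))
    have h2 := hN (lam i)
    have h3 := hN (mu i)
    simp only [f, sqElem, macQ_eq_dual, dual, map_smul, LinearMap.smul_apply, smul_eq_mul]
    field_simp
  rw [Real.norm_eq_abs]
  refine abs_le_of_sq_le_sq ?_ (add_nonneg hA hB)
  rw [hsq]
  nlinarith [mul_nonneg hA hB, sq_nonneg (∏ i, f i (lam i, mu i)),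
    sq_nonneg (∏ i, f i (lam (i + 1), mu i))]

/-- Summing the weights over `μ` gives a product of transfer matrix elements, up to a constant. -/
lemma hasSum_periodicWeight (hq : q ∈ Set.Ioo (0 : ℝ) 1) (ht : t ∈ Set.Ioo (0 : ℝ) 1)
    (hb : IsTimeSequence β n b) : ∃ c : ℝ, 0 < c ∧ ∀ lam : Fin (n + 1) → YSet,
      HasSum (fun mu : Fin (n + 1) → YSet =>
        periodicWeight q t (Real.exp (-β)) (rhoPlus γ β n b) (rhoMinus γ n b) lam mu)
        (c * ∏ i : Fin (n + 1), transfer q t γ (Real.exp (-(b ((i : ℕ) + 1) - b (i : ℕ))))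
          (lam i) (lam (i + 1))) := by
  have hP := isHomOrth_macP q t
  let w : Fin (n + 1) → ℝ := fun i => Real.exp (-(b ((i : ℕ) + 1) - b (i : ℕ)))
  refine ⟨∏ i, Real.exp (-((1 - t) / (1 - q) * γ ^ 2 * (w i - 1))),
    Finset.prod_pos fun i _ => Real.exp_pos _, fun lam => ?_⟩
  have hN : ∀ nu, form q t (macP q t nu) (macP q t nu) ≠ 0 := fun nu =>
    (hP.norm_pos hq ht nu).ne'
  refine hasSum_of_eq (hasSum_fin_prod _ _ fun i => hP.hasSum_skew hq ht (γ * (1 - w i)) (w i)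
    (macQ q t (lam i)) (macP q t (lam (i + 1))))
    (fun mu => periodicWeight_eq hq ht hb w (fun _ => rfl) lam mu) ?_
  rw [← Finset.prod_mul_distrib]
  refine prod_eq_of_cocycle _ _ (fun i => (form q t (macP q t (lam i)) (macP q t (lam i)))⁻¹)
    (fun i => inv_ne_zero (hN _)) fun i => ?_
  change Real.exp _ * transfer q t γ (w i) _ _ = _
  rw [transfer_eq hq ht, ← mul_assoc (Real.exp _), ← Real.exp_add, neg_add_cancel, Real.exp_zero,
    one_mul]
  have h1 := hN (lam i)
  simp only [macQ_eq_dual, dual, map_smul, LinearMap.smul_apply, smul_eq_mul]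
  field_simp

end

/-! ### Marginals of the stationary process -/

lemma hasSum_measureReal_eq_one {Ω ι : Type*} [MeasurableSpace Ω] (ℙ : Measure Ω)
    [IsProbabilityMeasure ℙ] [Countable ι] (Z : Ω → ι)
    (hZ : ∀ i, MeasurableSet {ω | Z ω = i}) : HasSum (fun i => ℙ.real {ω | Z ω = i}) 1 := by
  have hU : (⋃ i, {ω | Z ω = i}) = Set.univ := by ext ω; simp
  have hd : Pairwise (Function.onFun Disjoint fun i => {ω | Z ω = i}) := fun i j hij =>
    Set.disjoint_left.2 fun ω hi hj => hij (Eq.trans (Eq.symm hi) hj)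
  have h1 : ∑' i, ℙ {ω | Z ω = i} = 1 := by
    rw [← measure_iUnion hd hZ, hU, measure_univ]
  have h2 := ENNReal.hasSum_toReal (f := fun i => ℙ {ω | Z ω = i}) (by rw [h1]; simp)
  rwa [← ENNReal.tsum_toReal_eq fun i => measure_ne_top _ _, h1, ENNReal.toReal_one] at h2

lemma qPochhammer_nonneg {x : ℝ} (h0 : 0 < x) (h1 : x < 1) : 0 ≤ qPochhammer x x := by
  have hf : ∀ i : ℕ, 0 ≤ 1 - x * x ^ i := fun i => by
    rw [← pow_succ']
    exact sub_nonneg.2 (pow_le_one₀ h0.le h1.le)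
  rw [qPochhammer]
  by_cases h : Multipliable fun i : ℕ => 1 - x * x ^ i
  · exact ge_of_tendsto' h.hasProd fun s => Finset.prod_nonneg fun i _ => hf i
  · rw [tprod_eq_one_of_not_multipliable h]
    exact zero_le_one

end

end PeriodicMacdonald

open PeriodicMacdonald in
theorem mainTheorem9 (q t γ : ℝ) (hq : q ∈ Set.Ioo (0 : ℝ) 1) (ht : t ∈ Set.Ioo (0 : ℝ) 1)
    (hγ : 0 < γ) :
    -- the semigroup property of the transfer operators, in matrix elements
    (∀ u ∈ Set.Ioo (0 : ℝ) 1, ∀ v ∈ Set.Ioo (0 : ℝ) 1, ∀ lam nu : YSet,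
      HasSum (fun mu : YSet => transfer q t γ u lam mu * transfer q t γ v mu nu)
        (transfer q t γ (u * v) lam nu)) ∧
    -- the marginal laws
    (∀ {Ω : Type*} [MeasurableSpace Ω] (ℙ : MeasureTheory.Measure Ω)
      [MeasureTheory.IsProbabilityMeasure ℙ] (β : ℝ) (X : ℝ → Ω → YSet), 0 < β →
      IsStationaryPlancherel ℙ q t γ β X →
      ∀ (n : ℕ) (b : ℕ → ℝ), IsTimeSequence β n b →
        (Summable fun x : (Fin (n + 1) → YSet) × (Fin (n + 1) → YSet) =>
          periodicWeight q t (Real.exp (-β)) (rhoPlus γ β n b) (rhoMinus γ n b) x.1 x.2) ∧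
        0 < partitionFunction q t (Real.exp (-β)) (rhoPlus γ β n b) (rhoMinus γ n b) ∧
        ∀ lam : Fin (n + 1) → YSet,
          ℙ.real {ω | ∀ i : Fin (n + 1), X (b (i : ℕ)) ω = lam i} =
            periodicMacdonald q t (Real.exp (-β)) (rhoPlus γ β n b) (rhoMinus γ n b) lam) := by
  refine ⟨fun u _ v _ lam nu =>
    hasSum_transfer_mul_transfer hq ht (isHomOrth_macP q t) γ u v lam nu, ?_⟩
  intro Ω _ ℙ _ β X hβ hX n b hb
  have hsum := summable_periodicWeight (γ := γ) hq ht hb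
  obtain ⟨c, hc, hmu⟩ := hasSum_periodicWeight (γ := γ) hq ht hb
  have htotal : HasSum (fun lam : Fin (n + 1) → YSet =>
      ℙ.real {ω | ∀ i : Fin (n + 1), X (b (i : ℕ)) ω = lam i}) 1 := by
    have h := hasSum_measureReal_eq_one ℙ (fun ω (i : Fin (n + 1)) => X (b (i : ℕ)) ω)
      fun lam => by
        simp only [funext_iff, Set.ofPred_forall]
        exact MeasurableSet.iInter fun i => hX.measurable _ _
    simpa only [funext_iff] using h
  simp only [fun lam => hX.law n b hb lam] at htotal
  -- the total mass of the law determines the partition function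
  have hZ : qPochhammer (Real.exp (-β)) (Real.exp (-β)) *
      partitionFunction q t (Real.exp (-β)) (rhoPlus γ β n b) (rhoMinus γ n b) = c := by
    rw [partitionFunction, hsum.tsum_prod' fun lam => (hmu lam).summable]
    simp only [fun lam => (hmu lam).tsum_eq]
    rw [tsum_mul_left, mul_left_comm, ← tsum_mul_left, htotal.tsum_eq, mul_one]
  have hφ0 := qPochhammer_nonneg (Real.exp_pos (-β)) (Real.exp_lt_one_iff.2 (neg_lt_zero.2 hβ))
  have hφ : 0 < qPochhammer (Real.exp (-β)) (Real.exp (-β)) := by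
    refine lt_of_le_of_ne hφ0 fun h => hc.ne ?_
    rw [← hZ, ← h, zero_mul]
  have hZpos : 0 < partitionFunction q t (Real.exp (-β)) (rhoPlus γ β n b) (rhoMinus γ n b) :=
    pos_of_mul_pos_right (hZ ▸ hc) hφ0
  refine ⟨hsum, hZpos, fun lam => ?_⟩
  rw [hX.law n b hb lam, periodicMacdonald, (hmu lam).tsum_eq, eq_div_iff hZpos.ne', mul_right_comm,
    hZ]
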